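/- Let $R>0$ and $\varphi\in\mathbb{R}$, let $q_j=\bigl(R\cos(\varphi+\tfrac{2\pi j}{5}),\,R\sin(\varphi+\tfrac{2\pi j}{5})\bigr)$, $j\in\mathbb{Z}$, be the vertices of a regular pentagon in $\mathbb{R}^2$, and let $d_j=q_{j+1}-q_j$, $j=0,\dots,4$, be its edge vectors. Let $\varepsilon\in\{1,-1\}$, and let $$T_\varepsilon=\bigl\{\bigl((2+\cos 5t)\cos 2t,\ (2+\cos 5t)\sin 2t,\ \varepsilon\sin 5t\bigr) : t\in\mathbb{R}\bigr\}$$ be the $5_1$ knot, i.e. the $(2,5)$ torus knot, in one of its two mirror-image forms. Then there are eight vectors in $\mathbb{R}^3$, namely five vectors $w_0,\dots,w_4$ whose projections to the $xy$-plane are $d_0,\dots,d_4$, respectively, and three vertical vectors $(0,0,k_1),(0,0,k_2),(0,0,k_3)$ with $k_1,k_2,k_3$ nonzero integers, which can be reordered so that 1. the five vectors $w_j$ occur in the order $w_0,w_3,w_1,w_4,w_2$ (every third edge of the pentagon), and no two of the three vertical vectors are cyclically consecutive, so that they stand at three different corners of the star; and 2. placed tip-to-tail in this order, the eight vectors sum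 to $0$ and form a simple closed polygon (its eight vertices are distinct, and two different edges meet at most in common endpoints) which is ambient isotopic in $\mathbb{R}^3$ to $T_\varepsilon$. -/

import Mathlib

noncomputable section

/-- Two subsets `K`, `L` of a space `X` are ambient isotopic: there is a continuous family
`H t`, `t ∈ [0, 1]`, of homeomorphisms of `X` with `H 0 = id` and `H 1 (K) = L`. -/
def AmbientIsotopic {X : Type*} [TopologicalSpace X] (K L : Set X) : Prop :=
  ∃ H : unitInterval → X ≃ₜ X,
    Continuous (fun p : unitInterval × X => H p.1 p.2) ∧
      H 0 = Homeomorph.refl X ∧ H 1 '' K = L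

/-- The knot `5₁`, as the `(2, 5)` torus knot on the standard torus with radii `2` and `1`:
the curve winds twice around the `z`-axis and five times around the core circle.
The values `ε = 1` and `ε = -1` give the two mirror images. -/
def fiveOneKnot (ε : ℝ) : Set (EuclideanSpace ℝ (Fin 3)) :=
  Set.range fun t : ℝ =>
    !₂[(2 + Real.cos (5 * t)) * Real.cos (2 * t),
       (2 + Real.cos (5 * t)) * Real.sin (2 * t),
       ε * Real.sin (5 * t)]

/-- The orthogonal projection of `ℝ³` onto the horizontal coordinate plane. -/
def horizontalProj (x : EuclideanSpace ℝ (Fin 3)) : EuclideanSpace ℝ (Fin 2) := !₂[x 0, x 1]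

/-- The `j`-th vertex, counterclockwise and periodic in `j` with period `5`, of the regular
pentagon with centre `0` and circumradius `R`, whose vertex number `0` has polar angle `φ`. -/
def pentagonVertex (R φ : ℝ) (j : ℕ) : EuclideanSpace ℝ (Fin 2) :=
  !₂[R * Real.cos (φ + 2 * Real.pi * j / 5), R * Real.sin (φ + 2 * Real.pi * j / 5)]

/-- The `j`-th edge vector of that pentagon. -/
def pentagonEdge (R φ : ℝ) (j : ℕ) : EuclideanSpace ℝ (Fin 2) :=
  pentagonVertex R φ (j + 1) - pentagonVertex R φ j

/-- The polygon whose consecutive vertices are the tails of the vectors `u 0, u 1, …` placed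
tip-to-tail from the origin. If the vectors sum to zero, its `i`-th edge is the vector `u i`. -/
def tipToTail {E : Type*} [AddCommGroup E] {n : ℕ} (u : Fin n → E) : Polygon E n :=
  ⟨fun i => ∑ j ∈ Finset.Iio i, u j⟩

/-- A polygon is simple if its vertices are distinct and two different edges meet at most in
common endpoints. -/
def IsSimplePolygon {E : Type*} [AddCommGroup E] [Module ℝ E] {n : ℕ} (P : Polygon E n) : Prop :=
  Function.Injective P.vertices ∧
    ∀ i j : Fin n, i ≠ j →
      P.edgeSet ℝ i ∩ P.edgeSet ℝ j ⊆ {P i, P (finRotate n i)} ∩ {P j, P (finRotate n j)}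

/-- The eight vectors `w` project to the regular pentagon with parameters `R`, `φ`: the vectors
`w 0, …, w 4` project to its edge vectors in counterclockwise order, and `w 5, w 6, w 7` are
vertical vectors `(0, 0, k)` with `k` a nonzero integer. -/
def ProjectsToPentagon (R φ : ℝ) (w : Fin 8 → EuclideanSpace ℝ (Fin 3)) : Prop :=
  (∀ j : Fin 8, j.val < 5 → horizontalProj (w j) = pentagonEdge R φ j.val) ∧
    ∀ j : Fin 8, 5 ≤ j.val → ∃ k : ℤ, k ≠ 0 ∧ w j = !₂[0, 0, (k : ℝ)]

/-- The ordering `σ 0, …, σ 7` of the indices `0, …, 7` is a star ordering: the first five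
indices, which belong to the edges of the pentagon, occur in the order `0, 3, 1, 4, 2` (every
third edge), and no two of the indices `5, 6, 7`, which belong to the vertical vectors, are
cyclically adjacent, so that the vertical vectors stand at three different corners of the star. -/
def IsStarOrdering (σ : Equiv.Perm (Fin 8)) : Prop :=
  (∃ g : Fin 5 → Fin 8, StrictMono g ∧ ∀ m : Fin 5, (σ (g m)).val = 3 * m.val % 5) ∧
    ∀ i : Fin 8, 5 ≤ (σ i).val → (σ (i + 1)).val < 5

end

open Set Metric Filter Topology
open scoped NNReal

/-! Taken in the order of every third edge, the pentagon's edges form a pentagram that winds twice,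
clockwise, around its centre. With suitable heights the polygon is a closed braid on two strands
about the vertical line through the centre, and $T_\varepsilon$ is one too. The two can be compared
strand by strand over the same angle $\Theta$, which runs from $0$ to $-4\pi$.

Linear interpolation of radius and height at fixed $\Theta$ is harmless unless the points at angles
$\Theta$ and $\Theta-2\pi$ collide. So it suffices that the vector (difference of radii, difference
of heights) between the strands is never zero or opposite to that of the standard knot, which is
$2(\cos\frac{5\Theta}{2},\ \varepsilon\sin\frac{5\Theta}{2})$
(`ambientIsotopic_fiveOneKnot_of_braid`). For the pentagram, `star_crossing` verifies this. Away
from the crossings the radii differ with the sign of the cosine. At the five crossings the cosine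
vanishes, and the heights, chosen to alternate, differ with the sign of
$\varepsilon\sin\frac{5\Theta}{2}$.

The vertical edges spoil strict monotonicity of the angle. Their increments all have the same sign,
so a small twist of space about the axis, by an angle proportional to height, makes the angle
strictly monotone (`exists_starAngle_sub_strictAnti`). By compactness a small twist preserves
non-oppositeness (`eventually_star_not_opposite`). The same facts give injectivity of the closed
path, hence simplicity of the polygon.

A homotopy is promoted to an ambient isotopy without smoothness. If chords stay bounded below by a
multiple of the chords of the displacement, a small time step is a small Lipschitz perturbation of
the identity on the curve. It extends to all of space, where the identity plus a contraction is a
homeomorphism (`ambientIsotopic_of_linear_homotopy`). -/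

/-! ### Ambient isotopies from Lipschitz perturbations -/

theorem AmbientIsotopic.refl {X : Type*} [TopologicalSpace X] (K : Set X) :
    AmbientIsotopic K K :=
  ⟨fun _ => Homeomorph.refl X, by simpa using continuous_snd, rfl, by simp⟩

theorem AmbientIsotopic.trans {X : Type*} [TopologicalSpace X] {K L M : Set X}
    (h₁ : AmbientIsotopic K L) (h₂ : AmbientIsotopic L M) : AmbientIsotopic K M := by
  obtain ⟨H, hH, hH0, hH1⟩ := h₁
  obtain ⟨G, hG, hG0, hG1⟩ := h₂
  refine ⟨fun t => (H t).trans (G t), ?_, ?_, ?_⟩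
  · exact hG.comp (continuous_fst.prodMk hH)
  · simp only [hH0, hG0]
    rfl
  · change (fun x => G 1 (H 1 x)) '' K = M
    rw [← image_image, hH1, hG1]

/-- A map that differs from the identity by a contraction is the end of an ambient isotopy. -/
theorem ambientIsotopic_image_add_contraction {E : Type*} [NormedAddCommGroup E] [NormedSpace ℝ E]
    [CompleteSpace E] [Nontrivial E] {g : E → E} (hg : LipschitzWith (1 / 2) g) (K : Set E) :
    AmbientIsotopic K ((fun x => x + g x) '' K) := by
  have key : ∀ t : unitInterval, ApproximatesLinearOn (fun x => x + (t : ℝ) • g x)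
      ((ContinuousLinearEquiv.refl ℝ E : E ≃L[ℝ] E) : E →L[ℝ] E) univ (1 / 2) := by
    intro t x _ y _
    have h := hg.dist_le_mul x y
    rw [dist_eq_norm, dist_eq_norm] at h
    have e : x + (t : ℝ) • g x - (y + (t : ℝ) • g y)
        - ((ContinuousLinearEquiv.refl ℝ E : E ≃L[ℝ] E) : E →L[ℝ] E) (x - y)
        = (t : ℝ) • (g x - g y) := by
      simp only [ContinuousLinearEquiv.coe_refl, ContinuousLinearMap.coe_id', id_eq]
      rw [smul_sub]; abel
    simp only
    rw [e, norm_smul, Real.norm_of_nonneg t.2.1]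
    calc (t : ℝ) * ‖g x - g y‖ ≤ 1 * ‖g x - g y‖ :=
          mul_le_mul_of_nonneg_right t.2.2 (norm_nonneg _)
      _ ≤ _ := by simpa using h
  -- The identity survives any perturbation of Lipschitz constant below $\|\mathrm{id}^{-1}\|^{-1}$,
  -- which is $1$ in a nontrivial space.
  have hc : (1 / 2 : ℝ≥0) < ‖((ContinuousLinearEquiv.refl ℝ E).symm : E →L[ℝ] E)‖₊⁻¹ := by
    have : ‖((ContinuousLinearEquiv.refl ℝ E).symm : E →L[ℝ] E)‖₊ = 1 := by
      ext
      simp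
    rw [this, inv_one]
    exact NNReal.half_lt_self one_ne_zero
  refine ⟨fun t => (key t).toHomeomorph _ (Or.inr hc), ?_, ?_, ?_⟩
  · change Continuous fun p : unitInterval × E => p.2 + (p.1 : ℝ) • g p.2
    have := hg.continuous
    fun_prop
  · ext x
    change x + ((0 : unitInterval) : ℝ) • g x = x
    simp
  · change (fun x => x + ((1 : unitInterval) : ℝ) • g x) '' K = _
    simp

/-- The hypothesis makes $\gamma_1-\gamma_0$ a well-defined Lipschitz function of the point
$\gamma_0(x)$, even if $\gamma_0$ is not injective. Extending it from the curve to $E$ costs the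
factor `lipschitzExtensionConstant E`, so $c$ is $1/2$ divided by that factor. -/
theorem exists_ambientIsotopic_of_lipschitz_perturbation (E : Type*) [NormedAddCommGroup E]
    [NormedSpace ℝ E] [FiniteDimensional ℝ E] [Nontrivial E] :
    ∃ c > (0 : ℝ), ∀ {S : Type*} (γ₀ γ₁ : S → E),
      (∀ x y, ‖(γ₁ x - γ₀ x) - (γ₁ y - γ₀ y)‖ ≤ c * ‖γ₀ x - γ₀ y‖) →
      AmbientIsotopic (range γ₀) (range γ₁) := by
  have : CompleteSpace E := FiniteDimensional.complete ℝ E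
  set k := lipschitzExtensionConstant E with hk
  have hkpos : 0 < k := lipschitzExtensionConstant_pos E
  refine ⟨((1 / 2) / k : ℝ≥0), by positivity, ?_⟩
  intro S γ₀ γ₁ h
  classical
  let f : E → E := fun p => if hp : p ∈ range γ₀ then γ₁ hp.choose - p else 0
  have hf : ∀ x, f (γ₀ x) = γ₁ x - γ₀ x := by
    intro x
    have hp : γ₀ x ∈ range γ₀ := mem_range_self x
    have h1 : f (γ₀ x) = γ₁ hp.choose - γ₀ x := dif_pos hp
    have h2 : γ₀ hp.choose = γ₀ x := hp.choose_spec
    have h3 := h hp.choose x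
    rw [h2, sub_self, norm_zero, mul_zero] at h3
    have h4 := norm_le_zero_iff.1 h3
    rw [h1]
    rw [sub_sub_sub_cancel_right, sub_eq_zero] at h4
    rw [h4]
  have hfl : LipschitzOnWith ((1 / 2) / k) f (range γ₀) := by
    apply LipschitzOnWith.of_dist_le_mul
    rintro _ ⟨x, rfl⟩ _ ⟨y, rfl⟩
    rw [hf, hf, dist_eq_norm, dist_eq_norm]
    exact h x y
  obtain ⟨g, hg, hgf⟩ := hfl.extend_finite_dimension
  have hg' : LipschitzWith (1 / 2) g := by
    rwa [← hk, mul_div_cancel₀ _ hkpos.ne'] at hg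
  have := ambientIsotopic_image_add_contraction hg' (range γ₀)
  convert this using 1
  rw [← range_comp]
  congr 1
  ext1 x
  simp [← hgf (mem_range_self x), hf]

/-- If along the straight-line homotopy from `γ₀` to `γ₁` chords are bounded below in terms of
the chords of `γ₁ - γ₀`, then the images of `γ₀` and `γ₁` are ambient isotopic. -/
theorem ambientIsotopic_of_linear_homotopy {E : Type*} [NormedAddCommGroup E]
    [NormedSpace ℝ E] [FiniteDimensional ℝ E] [Nontrivial E] {S : Type*} (γ₀ γ₁ : S → E)
    {c : ℝ} (hc : 0 < c)
    (h : ∀ t ∈ Icc (0 : ℝ) 1, ∀ x y, c * ‖(γ₁ x - γ₀ x) - (γ₁ y - γ₀ y)‖ ≤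
      ‖(γ₀ x + t • (γ₁ x - γ₀ x)) - (γ₀ y + t • (γ₁ y - γ₀ y))‖) :
    AmbientIsotopic (range γ₀) (range γ₁) := by
  obtain ⟨d, hd, H⟩ := exists_ambientIsotopic_of_lipschitz_perturbation E
  -- With $N$ equal time steps the displacement per step is $1/N$ of the whole, and $1/N \le cd$
  -- makes each step an admissible perturbation of the curve reached so far.
  obtain ⟨N, hN⟩ := exists_nat_gt (1 / (c * d))
  have hN0 : (0 : ℝ) < N := lt_trans (by positivity) hN
  have step : ∀ n : ℕ, n ≤ N →
      AmbientIsotopic (range γ₀) (range fun x => γ₀ x + ((n : ℝ) / N) • (γ₁ x - γ₀ x)) := by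
    intro n
    induction n with
    | zero => intro _; simpa using AmbientIsotopic.refl _
    | succ n ih =>
      intro hn
      refine (ih (by omega)).trans (H _ _ fun x y => ?_)
      have ht : (n : ℝ) / N ∈ Icc (0 : ℝ) 1 := by
        refine ⟨by positivity, (div_le_one hN0).2 ?_⟩
        exact_mod_cast (by omega : n ≤ N)
      have h1 := h _ ht x y
      have e : (γ₀ x + (((n + 1 : ℕ) : ℝ) / N) • (γ₁ x - γ₀ x)
            - (γ₀ x + ((n : ℝ) / N) • (γ₁ x - γ₀ x)))
          - (γ₀ y + (((n + 1 : ℕ) : ℝ) / N) • (γ₁ y - γ₀ y)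
            - (γ₀ y + ((n : ℝ) / N) • (γ₁ y - γ₀ y)))
          = (1 / (N : ℝ)) • ((γ₁ x - γ₀ x) - (γ₁ y - γ₀ y)) := by
        push_cast
        rw [add_div]
        module
      rw [e, norm_smul, Real.norm_of_nonneg (by positivity)]
      have h2 : 1 / (N : ℝ) ≤ d * c := by
        rw [div_lt_iff₀ (by positivity)] at hN
        rw [div_le_iff₀ hN0]
        linarith
      calc 1 / (N : ℝ) * ‖(γ₁ x - γ₀ x) - (γ₁ y - γ₀ y)‖
          ≤ d * c * ‖(γ₁ x - γ₀ x) - (γ₁ y - γ₀ y)‖ :=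
            mul_le_mul_of_nonneg_right h2 (norm_nonneg _)
        _ = d * (c * ‖(γ₁ x - γ₀ x) - (γ₁ y - γ₀ y)‖) := by ring
        _ ≤ _ := mul_le_mul_of_nonneg_left h1 hd.le
  have := step N le_rfl
  rw [div_self hN0.ne'] at this
  simpa using this

/-! ### Cylindrical coordinates and closed braids on two strands -/

/-- The point of `ℝ³` with cylindrical coordinates `r`, `θ`, `z`. -/
noncomputable def cylPoint (r θ z : ℝ) : EuclideanSpace ℝ (Fin 3) := !₂[r * Real.cos θ, r * Real.sin θ, z]

theorem cylPoint_sub_same_angle (r r' θ z z' : ℝ) :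
    cylPoint r θ z - cylPoint r' θ z' = cylPoint (r - r') θ (z - z') := by
  ext i
  fin_cases i <;> simp [cylPoint] <;> ring

theorem cylPoint_homotopy (r r' θ z z' t : ℝ) :
    cylPoint r θ z + t • (cylPoint r' θ z' - cylPoint r θ z) =
      cylPoint (r + t * (r' - r)) θ (z + t * (z' - z)) := by
  ext i
  fin_cases i <;> simp [cylPoint] <;> ring

theorem norm_cylPoint_sub_sq (r θ z r' θ' z' : ℝ) :
    ‖cylPoint r θ z - cylPoint r' θ' z'‖ ^ 2 =
      (r - r') ^ 2 + 4 * r * r' * Real.sin ((θ - θ') / 2) ^ 2 + (z - z') ^ 2 := by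
  rw [EuclideanSpace.norm_sq_eq]
  have h1 : Real.sin ((θ - θ') / 2) ^ 2 = (1 - Real.cos (θ - θ')) / 2 := by
    rw [Real.sin_sq_eq_half_sub]
    ring_nf
  rw [h1, Real.cos_sub]
  simp only [cylPoint, Fin.sum_univ_three, PiLp.sub_apply, Real.norm_eq_abs, sq_abs]
  simp
  linear_combination r ^ 2 * Real.sin_sq_add_cos_sq θ + r' ^ 2 * Real.sin_sq_add_cos_sq θ'

theorem continuous_cylPoint {S : Type*} [TopologicalSpace S] {r θ z : S → ℝ} (hr : Continuous r)
    (hθ : Continuous θ) (hz : Continuous z) : Continuous fun s => cylPoint (r s) (θ s) (z s) := by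
  unfold cylPoint
  refine (PiLp.continuous_toLp 2 _).comp (continuous_pi fun i => ?_)
  fin_cases i <;> simp <;> fun_prop

theorem cylPoint_eq_iff {r θ z r' θ' z' : ℝ} (hr : 0 < r) (hr' : 0 < r') :
    cylPoint r θ z = cylPoint r' θ' z' ↔ r = r' ∧ Real.sin ((θ - θ') / 2) = 0 ∧ z = z' := by
  rw [← sub_eq_zero, ← norm_eq_zero, ← sq_eq_zero_iff, norm_cylPoint_sub_sq]
  constructor
  · intro h
    have h1 : 0 ≤ 4 * r * r' * Real.sin ((θ - θ') / 2) ^ 2 := by positivity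
    have h2 := sq_nonneg (r - r')
    have h3 := sq_nonneg (z - z')
    refine ⟨?_, ?_, ?_⟩
    · exact sub_eq_zero.1 (pow_eq_zero_iff two_ne_zero |>.1 (by linarith))
    · have : 4 * r * r' * Real.sin ((θ - θ') / 2) ^ 2 = 0 := by linarith
      simpa [hr.ne', hr'.ne'] using this
    · exact sub_eq_zero.1 (pow_eq_zero_iff two_ne_zero |>.1 (by linarith))
  · rintro ⟨rfl, h, rfl⟩
    simp [h]

theorem abs_le_mul_abs_sin_half {x : ℝ} (hx : |x| ≤ Real.pi) :
    |x| ≤ Real.pi * |Real.sin (x / 2)| := by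
  have h := Real.mul_abs_le_abs_sin (x := x / 2) (by rw [abs_div, abs_two]; linarith)
  rw [abs_div, abs_two] at h
  have := Real.pi_pos
  calc |x| = Real.pi * (2 / Real.pi * (|x| / 2)) := by field_simp
    _ ≤ _ := by gcongr

/-- A function on a closed curve winding twice around the axis that is Lipschitz in terms of the
lifted angle `Θ` has small increments between points with nearly equal lifted angles. -/
theorem abs_sub_le_mul_abs_sin_half {S : Type*} {Θ f : S → ℝ} {a b : S} {L : ℝ}
    (hΘ : ∀ s, Θ s ∈ Icc (-(4 * Real.pi)) 0) (ha : Θ a = 0) (hb : Θ b = -(4 * Real.pi))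
    (hf : ∀ s s', |f s - f s'| ≤ L * |Θ s - Θ s'|) (hab : f a = f b) (s s' : S)
    (hs : ¬ |Θ s - Θ s'| ∈ Icc Real.pi (3 * Real.pi)) :
    |f s - f s'| ≤ L * Real.pi * |Real.sin ((Θ s - Θ s') / 2)| := by
  have hL : 0 ≤ L := by
    have := (abs_nonneg _).trans (hf a b)
    rw [ha, hb] at this
    exact nonneg_of_mul_nonneg_left this (by simp [Real.pi_pos.ne'])
  wlog hle : Θ s ≤ Θ s' generalizing s s'
  · have h := this s' s (by rwa [abs_sub_comm]) (le_of_not_ge hle)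
    rwa [abs_sub_comm, ← neg_sub (Θ s), neg_div, Real.sin_neg, abs_neg] at h
  rw [mem_Icc, not_and_or, not_le, not_le] at hs
  rcases hs with hs | hs
  · calc |f s - f s'| ≤ L * |Θ s - Θ s'| := hf s s'
      _ ≤ L * (Real.pi * |Real.sin ((Θ s - Θ s') / 2)|) := by
        gcongr
        exact abs_le_mul_abs_sin_half hs.le
      _ = _ := by ring
  -- The points lie near opposite ends of the parameter range. Passing through the closing point,
  -- where $f(a)=f(b)$, the angular distances add up to $4\pi-|\Theta(s)-\Theta(s')| < \pi$.
  · rw [abs_of_nonpos (by linarith)] at hs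
    have h1 := hf s b
    have h2 := hf a s'
    rw [ha, zero_sub, abs_neg, abs_of_nonpos (hΘ s').2] at h2
    rw [hb, abs_of_nonneg (a := Θ s - _) (by linarith [(hΘ s).1])] at h1
    have h3 := abs_le_mul_abs_sin_half (x := Θ s - Θ s' + 4 * Real.pi) (by
      rw [abs_of_nonneg (by linarith [(hΘ s).1, (hΘ s').2])]; linarith)
    rw [abs_of_nonneg (by linarith [(hΘ s).1, (hΘ s').2]),
      show (Θ s - Θ s' + 4 * Real.pi) / 2 = (Θ s - Θ s') / 2 + 2 * Real.pi by ring,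
      Real.sin_add_two_pi] at h3
    calc |f s - f s'| = |(f s - f b) + (f a - f s')| := by rw [hab]; ring_nf
      _ ≤ |f s - f b| + |f a - f s'| := abs_add_le _ _
      _ ≤ L * (Θ s - -(4 * Real.pi)) + L * -Θ s' := add_le_add h1 h2
      _ = L * (Θ s - Θ s' + 4 * Real.pi) := by ring
      _ ≤ L * (Real.pi * |Real.sin ((Θ s - Θ s') / 2)|) := by gcongr
      _ = _ := by ring

theorem sin_half_eq_zero_of_abs_mem {x : ℝ} (hx : |x| ∈ Icc Real.pi (3 * Real.pi))
    (h : Real.sin (x / 2) = 0) : x = 2 * Real.pi ∨ x = -(2 * Real.pi) := by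
  have hpi := Real.pi_pos
  obtain ⟨n, hn⟩ := Real.sin_eq_zero_iff.1 h
  have hx' : x = 2 * n * Real.pi := by linarith
  have h1 : |(2 * n : ℝ)| * Real.pi ∈ Icc Real.pi (3 * Real.pi) := by
    rwa [hx', abs_mul, abs_of_pos hpi] at hx
  have h2 : (1 : ℝ) ≤ |(2 * n : ℝ)| := le_of_mul_le_mul_right (by linarith [h1.1]) hpi
  have h3 : |(2 * n : ℝ)| ≤ 3 := le_of_mul_le_mul_right h1.2 hpi
  have h2' : 1 ≤ |2 * n| := by exact_mod_cast h2
  have h3' : |2 * n| ≤ 3 := by exact_mod_cast h3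
  have : n = 1 ∨ n = -1 := by
    rw [abs_le] at h3'
    rw [le_abs] at h2'
    omega
  rcases this with rfl | rfl
  · left; rw [hx']; push_cast; ring
  · right; rw [hx']; push_cast; ring

/-- Supplies one chord constant for both regimes of the braid homotopy below: points on different
strands ($B$, $m$) and nearby points of one strand ($A$, $\rho$). -/
theorem exists_pos_mul_le_and_sq_mul_le {A B m ρ : ℝ} (hB : 0 ≤ B) (hA : 0 ≤ A) (hm : 0 < m)
    (hρ : 0 < ρ) : ∃ c > 0, c * B ≤ m ∧ c ^ 2 * A ≤ (2 * ρ) ^ 2 := by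
  refine ⟨min (m / (B + 1)) (2 * ρ / (A + 1)), by positivity, ?_, ?_⟩
  · calc _ ≤ m / (B + 1) * B := by
          gcongr
          exact min_le_left _ _
      _ ≤ m := by
        rw [div_mul_eq_mul_div, div_le_iff₀ (by positivity)]
        nlinarith
  · calc _ ≤ (2 * ρ / (A + 1)) ^ 2 * A := by
          gcongr
          exact min_le_right _ _
      _ = (2 * ρ) ^ 2 * (A / (A + 1) ^ 2) := by field_simp
      _ ≤ (2 * ρ) ^ 2 * 1 := by
          gcongr
          rw [div_le_one (by positivity)]
          nlinarith
      _ = _ := mul_one _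

/-- Two closed braids with two strands, given in cylindrical coordinates over the same lifted
angle `Θ`, are ambient isotopic if the straight-line homotopy keeps the strands apart. -/
theorem ambientIsotopic_of_braid_homotopy {S : Type*} [TopologicalSpace S] [CompactSpace S]
    {Θ r z R Z : S → ℝ} {a b : S} {L : ℝ} (hcΘ : Continuous Θ) (hcr : Continuous r)
    (hcz : Continuous z) (hcR : Continuous R) (hcZ : Continuous Z)
    (hΘ : ∀ s, Θ s ∈ Icc (-(4 * Real.pi)) 0) (ha : Θ a = 0) (hb : Θ b = -(4 * Real.pi))
    (hr : ∀ s s', |r s - r s'| ≤ L * |Θ s - Θ s'|) (hz : ∀ s s', |z s - z s'| ≤ L * |Θ s - Θ s'|)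
    (hR : ∀ s s', |R s - R s'| ≤ L * |Θ s - Θ s'|) (hZ : ∀ s s', |Z s - Z s'| ≤ L * |Θ s - Θ s'|)
    (hrab : r a = r b) (hzab : z a = z b) (hRab : R a = R b) (hZab : Z a = Z b)
    (hr0 : ∀ s, 0 < r s) (hR0 : ∀ s, 0 < R s)
    (hv : ∀ t ∈ Icc (0 : ℝ) 1, ∀ s s', Θ s - Θ s' = 2 * Real.pi →
      (1 - t) * (r s - r s') + t * (R s - R s') = 0 →
      (1 - t) * (z s - z s') + t * (Z s - Z s') = 0 → False) :
    AmbientIsotopic (range fun s => cylPoint (r s) (Θ s) (z s))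
      (range fun s => cylPoint (R s) (Θ s) (Z s)) := by
  have hpi := Real.pi_pos
  have hL : 0 ≤ L := by
    have := (abs_nonneg _).trans (hr a b)
    rw [ha, hb] at this
    exact nonneg_of_mul_nonneg_left this (by simp [Real.pi_pos.ne'])
  obtain ⟨s₁, -, hs₁⟩ := isCompact_univ.exists_isMinOn ⟨a, mem_univ a⟩ hcr.continuousOn
  obtain ⟨s₂, -, hs₂⟩ := isCompact_univ.exists_isMinOn ⟨a, mem_univ a⟩ hcR.continuousOn
  set ρ := min (r s₁) (R s₂) with hρ
  have hρ0 : 0 < ρ := lt_min (hr0 _) (hR0 _)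
  have hρr : ∀ s, ρ ≤ r s := fun s => (min_le_left _ _).trans (hs₁ (mem_univ s))
  have hρR : ∀ s, ρ ≤ R s := fun s => (min_le_right _ _).trans (hs₂ (mem_univ s))
  obtain ⟨s₃, -, hs₃⟩ := isCompact_univ.exists_isMaxOn ⟨a, mem_univ a⟩
    (hcR.sub hcr).abs.continuousOn
  set M := |R s₃ - r s₃| with hM
  have hM' : ∀ s, |R s - r s| ≤ M := fun s => hs₃ (mem_univ s)
  have hrt : ∀ t ∈ Icc (0 : ℝ) 1, ∀ s, ρ ≤ r s + t * (R s - r s) := by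
    intro t ht s
    nlinarith [mul_nonneg ht.1 (sub_nonneg.2 (hρR s)),
      mul_nonneg (sub_nonneg.2 ht.2) (sub_nonneg.2 (hρr s))]
  -- On this compact set of parameters the chord vanishes only at an angle difference of $\pm2\pi$,
  -- which `hv` excludes, so it has a positive minimum.
  let T : Set (unitInterval × S × S) := {p | |Θ p.2.1 - Θ p.2.2| ∈ Icc Real.pi (3 * Real.pi)}
  have hT : IsCompact T := by
    apply IsClosed.isCompact
    exact isClosed_Icc.preimage (by fun_prop :
      Continuous fun p : unitInterval × S × S => |Θ p.2.1 - Θ p.2.2|)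
  let G : unitInterval × S × S → ℝ := fun p =>
    ‖cylPoint (r p.2.1 + p.1 * (R p.2.1 - r p.2.1)) (Θ p.2.1) (z p.2.1 + p.1 * (Z p.2.1 - z p.2.1))
      - cylPoint (r p.2.2 + p.1 * (R p.2.2 - r p.2.2)) (Θ p.2.2)
        (z p.2.2 + p.1 * (Z p.2.2 - z p.2.2))‖
  have hG : Continuous G := by
    refine ((continuous_cylPoint ?_ ?_ ?_).sub (continuous_cylPoint ?_ ?_ ?_)).norm <;> fun_prop
  have hGpos : ∀ p ∈ T, 0 < G p := by
    rintro ⟨t, s, s'⟩ hp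
    refine norm_pos_iff.2 (sub_ne_zero.2 fun h => ?_)
    rw [cylPoint_eq_iff (hρ0.trans_le (hrt t t.2 s)) (hρ0.trans_le (hrt t t.2 s'))] at h
    obtain ⟨h1, h2, h3⟩ := h
    simp only at h1 h2 h3
    rcases sin_half_eq_zero_of_abs_mem hp h2 with h4 | h4
    · exact hv t t.2 s s' h4 (by linarith) (by linarith)
    · exact hv t t.2 s' s (by linarith) (by linarith) (by linarith)
  obtain ⟨m, hm0, hm⟩ : ∃ m > 0, ∀ p ∈ T, m ≤ G p := by
    rcases T.eq_empty_or_nonempty with hE | hne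
    · exact ⟨1, one_pos, by simp [hE]⟩
    · obtain ⟨p, hp, hmin⟩ := hT.exists_isMinOn hne hG.continuousOn
      exact ⟨G p, hGpos p hp, fun q hq => hmin hq⟩
  have hDc : Continuous fun p : S × S =>
      ‖cylPoint (R p.1 - r p.1) (Θ p.1) (Z p.1 - z p.1)
        - cylPoint (R p.2 - r p.2) (Θ p.2) (Z p.2 - z p.2)‖ := by
    refine ((continuous_cylPoint ?_ ?_ ?_).sub (continuous_cylPoint ?_ ?_ ?_)).norm <;> fun_prop
  obtain ⟨B, hB⟩ := (isCompact_range hDc).bddAbove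
  have hB' : ∀ s s', ‖cylPoint (R s - r s) (Θ s) (Z s - z s)
      - cylPoint (R s' - r s') (Θ s') (Z s' - z s')‖ ≤ B := fun s s' => hB ⟨(s, s'), rfl⟩
  have hB0 : 0 ≤ B := (norm_nonneg _).trans (hB' a a)
  set A := 2 * (2 * L * Real.pi) ^ 2 + 4 * M ^ 2 with hA
  have hA0 : 0 ≤ A := by positivity
  obtain ⟨c, hc0, hcB, hcA⟩ := exists_pos_mul_le_and_sq_mul_le hB0 hA0 hm0 hρ0
  refine ambientIsotopic_of_linear_homotopy _ _ hc0 ?_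
  intro t ht s s'
  rw [cylPoint_homotopy, cylPoint_homotopy, cylPoint_sub_same_angle, cylPoint_sub_same_angle]
  by_cases hss : |Θ s - Θ s'| ∈ Icc Real.pi (3 * Real.pi)
  · calc _ ≤ c * B := by
          gcongr
          exact hB' s s'
      _ ≤ m := hcB
      _ ≤ _ := hm (⟨t, ht⟩, s, s') hss
  -- Here the points are neighbours along the closed curve. The displacement chord is at most, and
  -- the curve chord at least, a constant times $|\sin((\Theta(s)-\Theta(s'))/2)|$.
  · have bnd : ∀ {f g : S → ℝ}, (∀ s s', |f s - f s'| ≤ L * |Θ s - Θ s'|) →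
        (∀ s s', |g s - g s'| ≤ L * |Θ s - Θ s'|) → f a = f b → g a = g b →
        (f s - g s - (f s' - g s')) ^ 2 ≤
          (2 * L * Real.pi) ^ 2 * Real.sin ((Θ s - Θ s') / 2) ^ 2 := by
      intro f g hf hg hfab hgab
      have h1 := abs_sub_le_mul_abs_sin_half hΘ ha hb hf hfab s s' hss
      have h2 := abs_sub_le_mul_abs_sin_half hΘ ha hb hg hgab s s' hss
      rw [← mul_pow]
      apply sq_le_sq.2
      rw [abs_mul, abs_of_nonneg (by positivity : 0 ≤ 2 * L * Real.pi)]
      calc |f s - g s - (f s' - g s')| = |(f s - f s') - (g s - g s')| := by ring_nf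
        _ ≤ |f s - f s'| + |g s - g s'| := abs_sub _ _
        _ ≤ _ := by linarith
    have h1 := bnd hR hr hRab hrab
    have h2 := bnd hZ hz hZab hzab
    set D := Real.sin ((Θ s - Θ s') / 2) ^ 2 with hD
    have hD0 : 0 ≤ D := sq_nonneg _
    have hup : ‖cylPoint (R s - r s) (Θ s) (Z s - z s)
        - cylPoint (R s' - r s') (Θ s') (Z s' - z s')‖ ^ 2 ≤ A * D := by
      rw [norm_cylPoint_sub_sq, ← hD]
      have h3 : (R s - r s) * (R s' - r s') ≤ M ^ 2 := by
        calc _ ≤ |(R s - r s) * (R s' - r s')| := le_abs_self _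
          _ = |R s - r s| * |R s' - r s'| := abs_mul _ _
          _ ≤ M * M := mul_le_mul (hM' s) (hM' s') (abs_nonneg _) (abs_nonneg _)
          _ = M ^ 2 := by ring
      have h4 := mul_le_mul_of_nonneg_right h3 hD0
      rw [hA]
      linarith
    have hlow : (2 * ρ) ^ 2 * D ≤ ‖cylPoint (r s + t * (R s - r s)) (Θ s) (z s + t * (Z s - z s))
        - cylPoint (r s' + t * (R s' - r s')) (Θ s') (z s' + t * (Z s' - z s'))‖ ^ 2 := by
      rw [norm_cylPoint_sub_sq, ← hD]
      have h3 : ρ * ρ ≤ (r s + t * (R s - r s)) * (r s' + t * (R s' - r s')) :=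
        mul_le_mul (hrt t ht s) (hrt t ht s') hρ0.le (hρ0.le.trans (hrt t ht s))
      have h4 := mul_le_mul_of_nonneg_right h3 hD0
      nlinarith [sq_nonneg (r s + t * (R s - r s) - (r s' + t * (R s' - r s'))),
        sq_nonneg (z s + t * (Z s - z s) - (z s' + t * (Z s' - z s')))]
    refine abs_le_of_sq_le_sq' ?_ (norm_nonneg _) |>.2
    rw [mul_pow]
    calc _ ≤ c ^ 2 * (A * D) := by gcongr
      _ = c ^ 2 * A * D := by ring
      _ ≤ (2 * ρ) ^ 2 * D := by gcongr
      _ ≤ _ := hlow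

theorem range_cylPoint_eq_fiveOneKnot {S : Type*} {Θ : S → ℝ} (ε : ℝ)
    (hΘ : Icc (-(4 * Real.pi)) 0 ⊆ range Θ) :
    (range fun s => cylPoint (2 + Real.cos (5 * Θ s / 2)) (Θ s) (ε * Real.sin (5 * Θ s / 2))) =
      fiveOneKnot ε := by
  have hpi := Real.pi_pos
  ext p
  constructor
  · rintro ⟨s, rfl⟩
    refine ⟨Θ s / 2, ?_⟩
    simp only [cylPoint]
    rw [show 5 * (Θ s / 2) = 5 * Θ s / 2 by ring, show 2 * (Θ s / 2) = Θ s by ring]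
  · rintro ⟨t, rfl⟩
    have hp : (0 : ℝ) < 2 * Real.pi := by positivity
    obtain ⟨n, hn, -⟩ := existsUnique_add_zsmul_mem_Ico hp t (-(2 * Real.pi))
    rw [zsmul_eq_mul] at hn
    obtain ⟨s, hs⟩ := hΘ (show 2 * (t + n * (2 * Real.pi)) ∈ Icc (-(4 * Real.pi)) 0 from
      ⟨by linarith [hn.1], by linarith [hn.2]⟩)
    refine ⟨s, ?_⟩
    have h1 : 5 * Θ s / 2 = 5 * t + (5 * n : ℤ) * (2 * Real.pi) := by rw [hs]; push_cast; ring
    have h2 : Θ s = 2 * t + (2 * n : ℤ) * (2 * Real.pi) := by rw [hs]; push_cast; ring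
    simp only [cylPoint]
    rw [h1, h2]
    simp only [Real.cos_add_int_mul_two_pi, Real.sin_add_int_mul_two_pi]

/-- A closed braid with two strands is ambient isotopic to the knot `5₁` if the difference of
its strands is nowhere opposite to that of the standard position of `5₁`. -/
theorem ambientIsotopic_fiveOneKnot_of_braid {S : Type*} [TopologicalSpace S] [CompactSpace S]
    [PreconnectedSpace S] {Θ r z : S → ℝ} {a b : S} {L ε : ℝ} (hcΘ : Continuous Θ)
    (hcr : Continuous r) (hcz : Continuous z)
    (hΘ : ∀ s, Θ s ∈ Icc (-(4 * Real.pi)) 0) (ha : Θ a = 0) (hb : Θ b = -(4 * Real.pi))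
    (hr : ∀ s s', |r s - r s'| ≤ L * |Θ s - Θ s'|) (hz : ∀ s s', |z s - z s'| ≤ L * |Θ s - Θ s'|)
    (hrab : r a = r b) (hzab : z a = z b) (hr0 : ∀ s, 0 < r s)
    (hv : ∀ t ∈ Icc (0 : ℝ) 1, ∀ s s', Θ s - Θ s' = 2 * Real.pi →
      (1 - t) * (r s - r s') + t * (2 * Real.cos (5 * Θ s / 2)) = 0 →
      (1 - t) * (z s - z s') + t * (ε * (2 * Real.sin (5 * Θ s / 2))) = 0 → False) :
    AmbientIsotopic (range fun s => cylPoint (r s) (Θ s) (z s)) (fiveOneKnot ε) := by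
  have hsurj : Icc (-(4 * Real.pi)) 0 ⊆ range Θ := by
    rw [← ha, ← hb]
    exact intermediate_value_univ b a hcΘ
  rw [← range_cylPoint_eq_fiveOneKnot ε hsurj]
  have hpos : ∀ x : ℝ, 0 < 2 + Real.cos x := fun x => by linarith [Real.neg_one_le_cos x]
  have hLcos : ∀ s s', |2 + Real.cos (5 * Θ s / 2) - (2 + Real.cos (5 * Θ s' / 2))| ≤
      5 / 2 * |Θ s - Θ s'| := by
    intro s s'
    have h := Real.lipschitzWith_cos.dist_le_mul (5 * Θ s / 2) (5 * Θ s' / 2)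
    rw [Real.dist_eq, Real.dist_eq, ← sub_div, ← mul_sub, abs_div, abs_mul] at h
    norm_num at h
    rw [add_sub_add_left_eq_sub]
    linarith
  have hLsin : ∀ s s', |ε * Real.sin (5 * Θ s / 2) - ε * Real.sin (5 * Θ s' / 2)| ≤
      |ε| * (5 / 2) * |Θ s - Θ s'| := by
    intro s s'
    have h := Real.lipschitzWith_sin.dist_le_mul (5 * Θ s / 2) (5 * Θ s' / 2)
    rw [Real.dist_eq, Real.dist_eq, ← sub_div, ← mul_sub, abs_div, abs_mul] at h
    norm_num at h
    rw [← mul_sub, abs_mul, mul_assoc]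
    gcongr
    linarith
  have hcos : Real.cos (5 * (-(4 * Real.pi)) / 2) = 1 := by
    rw [show 5 * (-(4 * Real.pi)) / 2 = ((-5 : ℤ) : ℝ) * (2 * Real.pi) by push_cast; ring,
      Real.cos_int_mul_two_pi]
  have hsin : Real.sin (5 * (-(4 * Real.pi)) / 2) = 0 := by
    rw [show 5 * (-(4 * Real.pi)) / 2 = ((-10 : ℤ) : ℝ) * Real.pi by push_cast; ring,
      Real.sin_int_mul_pi]
  have mono : ∀ {x L' : ℝ} {s s' : S}, x ≤ L' * |Θ s - Θ s'| → L' ≤ max L (max (5 / 2) (|ε| * (5 / 2))) →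
      x ≤ max L (max (5 / 2) (|ε| * (5 / 2))) * |Θ s - Θ s'| := fun h h' =>
    h.trans (mul_le_mul_of_nonneg_right h' (abs_nonneg _))
  refine ambientIsotopic_of_braid_homotopy (a := a) (b := b)
    (L := max L (max (5 / 2) (|ε| * (5 / 2)))) hcΘ hcr hcz
    (by fun_prop) (by fun_prop) hΘ ha hb (fun s s' => mono (hr s s') (by simp))
    (fun s s' => mono (hz s s') (by simp)) (fun s s' => mono (hLcos s s') (by simp))
    (fun s s' => mono (hLsin s s') (by simp))
    hrab hzab (by rw [ha, hb, hcos]; simp) (by rw [ha, hb, hsin]; simp) hr0 (fun s => hpos _) ?_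
  intro t ht s s' hs h1 h2
  -- Going back by $2\pi$ in $\Theta$ changes $5\Theta/2$ by $-5\pi$, an odd multiple of $\pi$. The
  -- two strands of the standard knot are thus antipodal on the meridian circle.
  have e : 5 * Θ s' / 2 = 5 * Θ s / 2 - Real.pi - ((2 : ℤ) : ℝ) * (2 * Real.pi) := by
    push_cast; linarith
  rw [e, Real.cos_sub_int_mul_two_pi, Real.cos_sub_pi] at h1
  rw [e, Real.sin_sub_int_mul_two_pi, Real.sin_sub_pi] at h2
  exact hv t ht s s' hs (by linarith) (by linarith)

/-! ### Helical twists of space -/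

/-- The homeomorphism of `ℝ³` that translates by `(c₀, c₁, 0)` and then rotates each horizontal
plane about the `z`-axis by the angle `α + κ z`. -/
noncomputable def helicalHomeomorph (c₀ c₁ α κ : ℝ) :
    EuclideanSpace ℝ (Fin 3) ≃ₜ EuclideanSpace ℝ (Fin 3) where
  toFun p := !₂[Real.cos (α + κ * p 2) * (p 0 + c₀) - Real.sin (α + κ * p 2) * (p 1 + c₁),
    Real.sin (α + κ * p 2) * (p 0 + c₀) + Real.cos (α + κ * p 2) * (p 1 + c₁), p 2]
  invFun p := !₂[Real.cos (α + κ * p 2) * p 0 + Real.sin (α + κ * p 2) * p 1 - c₀,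
    -Real.sin (α + κ * p 2) * p 0 + Real.cos (α + κ * p 2) * p 1 - c₁, p 2]
  left_inv p := by
    have h := Real.sin_sq_add_cos_sq (α + κ * p 2)
    ext i
    fin_cases i
    · simp
      linear_combination (p 0 + c₀) * h
    · simp
      linear_combination (p 1 + c₁) * h
    · simp
  right_inv p := by
    have h := Real.sin_sq_add_cos_sq (α + κ * p 2)
    ext i
    fin_cases i
    · simp
      linear_combination (p 0) * h
    · simp
      linear_combination (p 1) * h
    · simp
  continuous_toFun := by
    refine (PiLp.continuous_toLp 2 _).comp (continuous_pi fun i => ?_)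
    fin_cases i <;> simp <;> fun_prop
  continuous_invFun := by
    refine (PiLp.continuous_toLp 2 _).comp (continuous_pi fun i => ?_)
    fin_cases i <;> simp <;> fun_prop

theorem helicalHomeomorph_apply (c₀ c₁ α κ : ℝ) (p : EuclideanSpace ℝ (Fin 3)) :
    helicalHomeomorph c₀ c₁ α κ p =
      !₂[Real.cos (α + κ * p 2) * (p 0 + c₀) - Real.sin (α + κ * p 2) * (p 1 + c₁),
        Real.sin (α + κ * p 2) * (p 0 + c₀) + Real.cos (α + κ * p 2) * (p 1 + c₁), p 2] := rfl

/-- Multiplying all four parameters by $t$ joins the homeomorphism to the identity. -/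
theorem ambientIsotopic_image_helicalHomeomorph (c₀ c₁ α κ : ℝ)
    (K : Set (EuclideanSpace ℝ (Fin 3))) :
    AmbientIsotopic K (helicalHomeomorph c₀ c₁ α κ '' K) := by
  refine ⟨fun t => helicalHomeomorph (t * c₀) (t * c₁) (t * α) (t * κ), ?_, ?_, by simp⟩
  · simp only [helicalHomeomorph_apply]
    refine (PiLp.continuous_toLp 2 _).comp (continuous_pi fun i => ?_)
    fin_cases i <;> simp <;> fun_prop
  · ext p i
    rw [helicalHomeomorph_apply]
    fin_cases i <;> simp

theorem helicalHomeomorph_apply_of_polar {c₀ c₁ α κ ρ θ : ℝ} {p : EuclideanSpace ℝ (Fin 3)}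
    (h0 : p 0 + c₀ = ρ * Real.cos (θ - α)) (h1 : p 1 + c₁ = ρ * Real.sin (θ - α)) :
    helicalHomeomorph c₀ c₁ α κ p = cylPoint ρ (θ + κ * p 2) (p 2) := by
  rw [helicalHomeomorph_apply, h0, h1, cylPoint,
    show θ + κ * p 2 = (α + κ * p 2) + (θ - α) by ring, Real.cos_add (α + κ * p 2),
    Real.sin_add (α + κ * p 2)]
  ext i
  fin_cases i <;> simp <;> ring

/-! ### Ramps and tip-to-tail polygons -/

/-- The piecewise linear function that is `0` on `(-∞, 0]`, the identity on `[0, 1]` and `1` on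
`[1, ∞)`. -/
noncomputable def ramp (x : ℝ) : ℝ := max 0 (min x 1)

theorem continuous_ramp : Continuous ramp := by unfold ramp; fun_prop

theorem ramp_mem (x : ℝ) : ramp x ∈ Icc (0 : ℝ) 1 := ⟨le_max_left _ _, by simp [ramp]⟩

theorem ramp_mono : Monotone ramp := fun x y h => by unfold ramp; gcongr

theorem ramp_of_nonpos {x : ℝ} (h : x ≤ 0) : ramp x = 0 := by
  rw [ramp, max_eq_left ((min_le_left _ _).trans h)]

theorem ramp_of_one_le {x : ℝ} (h : 1 ≤ x) : ramp x = 1 := by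
  rw [ramp, min_eq_right h, max_eq_right zero_le_one]

theorem ramp_of_mem {x : ℝ} (h : x ∈ Icc (0 : ℝ) 1) : ramp x = x := by
  rw [ramp, min_eq_left h.2, max_eq_right h.1]

/-- The sum of the functions `f i` composed with ramps, which runs through `f 0, f 1, …` one
after the other. -/
theorem sum_ramp_eq {A : Type*} [AddCommMonoid A] {n : ℕ} (f : Fin n → ℝ → A)
    (hf : ∀ i, f i 0 = 0) (j : Fin n) {x : ℝ} (hx : x ∈ Icc (0 : ℝ) 1) :
    ∑ i, f i (ramp ((j : ℕ) + x - (i : ℕ))) = ∑ i ∈ Finset.Iio j, f i 1 + f j x := by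
  classical
  have h : ∀ i, f i (ramp ((j : ℕ) + x - (i : ℕ))) =
      (if i ∈ Finset.Iio j then f i 1 else 0) + (if i = j then f j x else 0) := by
    intro i
    simp only [Finset.mem_Iio]
    rcases lt_trichotomy i j with hij | rfl | hij
    · have : ((i : ℕ) : ℝ) + 1 ≤ (j : ℕ) := by exact_mod_cast Nat.succ_le_of_lt (Fin.lt_def.1 hij)
      rw [ramp_of_one_le (by linarith [hx.1]), if_pos hij, if_neg hij.ne, add_zero]
    · rw [if_neg (lt_irrefl _), if_pos rfl, zero_add, add_sub_cancel_left, ramp_of_mem hx]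
    · have : ((j : ℕ) : ℝ) + 1 ≤ (i : ℕ) := by exact_mod_cast Nat.succ_le_of_lt (Fin.lt_def.1 hij)
      rw [ramp_of_nonpos (by linarith [hx.2]), if_neg hij.not_gt, if_neg hij.ne', hf, add_zero]
  rw [Finset.sum_congr rfl fun i _ => h i, Finset.sum_add_distrib, Finset.sum_ite_mem]
  simp

/-- The closed path that runs through the vectors `u 0, u 1, …` placed tip-to-tail. -/
noncomputable def tipToTailPath {E : Type*} [AddCommGroup E] [Module ℝ E] {n : ℕ} (u : Fin n → E) (s : ℝ) : E :=
  ∑ i : Fin n, ramp (s - (i : ℕ)) • u i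

theorem tipToTailPath_add {E : Type*} [AddCommGroup E] [Module ℝ E] {n : ℕ} (u : Fin n → E)
    (j : Fin n) {x : ℝ} (hx : x ∈ Icc (0 : ℝ) 1) :
    tipToTailPath u ((j : ℕ) + x) = ∑ i ∈ Finset.Iio j, u i + x • u j := by
  rw [tipToTailPath, sum_ramp_eq (fun i y => y • u i) (by simp) j hx]
  simp

theorem tipToTail_apply {E : Type*} [AddCommGroup E] {n : ℕ} (u : Fin n → E) (j : Fin n) :
    tipToTail u j = ∑ i ∈ Finset.Iio j, u i := rfl

theorem tipToTail_finRotate {E : Type*} [AddCommGroup E] {n : ℕ} (u : Fin n → E)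
    (hu : ∑ i, u i = 0) (j : Fin n) :
    tipToTail u (finRotate n j) = tipToTail u j + u j := by
  obtain _ | n := n
  · exact j.elim0
  have h1 : tipToTail u j + u j = ∑ i ∈ Finset.Iic j, u i := by
    rw [tipToTail_apply, ← Finset.Iio_insert, Finset.sum_insert (by simp), add_comm]
  rw [h1]
  rcases eq_or_ne j (Fin.last n) with rfl | hj
  · rw [finRotate_last, ← Fin.top_eq_last, Finset.Iic_top, hu, tipToTail_apply]
    exact Finset.sum_eq_zero fun i hi => absurd (Finset.mem_Iio.1 hi) (Fin.not_lt_zero i)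
  · have h2 : finRotate (n + 1) j = j + 1 := by simp
    rw [h2, tipToTail_apply]
    have h3 : Finset.Iio (j + 1) = Finset.Iic j := by
      ext i
      have hlt := Fin.val_lt_last hj
      rw [Finset.mem_Iio, Finset.mem_Iic, Fin.lt_def, Fin.le_def,
        Fin.val_add_one_of_lt (Fin.lt_last_iff_ne_last.2 hj)]
      omega
    rw [h3]

theorem edgeSet_tipToTail {E : Type*} [AddCommGroup E] [Module ℝ E] {n : ℕ} (u : Fin n → E)
    (hu : ∑ i, u i = 0) (j : Fin n) :
    (tipToTail u).edgeSet ℝ j = tipToTailPath u '' Icc ((j : ℕ) : ℝ) ((j : ℕ) + 1) := by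
  have h : ∀ x ∈ Icc (0 : ℝ) 1, tipToTailPath u ((j : ℕ) + x) = (tipToTail u).edgePath ℝ j x := by
    intro x hx
    rw [tipToTailPath_add u j hx, Polygon.edgePath, tipToTail_finRotate u hu,
      AffineMap.lineMap_apply, vsub_eq_sub, vadd_eq_add, add_sub_cancel_left, add_comm]
    rfl
  rw [Polygon.edgeSet_eq_image_edgePath, ← image_congr h]
  ext p
  constructor
  · rintro ⟨x, hx, rfl⟩
    exact ⟨_, ⟨by linarith [hx.1], by linarith [hx.2]⟩, rfl⟩
  · rintro ⟨x, hx, rfl⟩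
    exact ⟨x - (j : ℕ), ⟨by linarith [hx.1], by linarith [hx.2]⟩, by simp⟩

theorem exists_fin_mem_Icc {n : ℕ} {s : ℝ} (hs : s ∈ Icc (0 : ℝ) n) (hn : 0 < n) :
    ∃ j : Fin n, s ∈ Icc ((j : ℕ) : ℝ) ((j : ℕ) + 1) := by
  rcases hs.2.eq_or_lt with rfl | h
  · refine ⟨⟨n - 1, by omega⟩, ?_⟩
    have : ((n - 1 : ℕ) : ℝ) + 1 = n := by exact_mod_cast Nat.succ_pred_eq_of_pos hn
    constructor <;> simp only <;> linarith
  · exact ⟨⟨⌊s⌋₊, (Nat.floor_lt hs.1).2 h⟩, Nat.floor_le hs.1, (Nat.lt_floor_add_one s).le⟩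

theorem boundary_tipToTail {E : Type*} [AddCommGroup E] [Module ℝ E] {n : ℕ} (u : Fin n → E)
    (hn : 0 < n) (hu : ∑ i, u i = 0) :
    (tipToTail u).boundary ℝ = tipToTailPath u '' Icc (0 : ℝ) n := by
  rw [Polygon.boundary, iUnion_congr (edgeSet_tipToTail u hu), ← image_iUnion]
  congr 1
  ext s
  rw [mem_iUnion]
  constructor
  · rintro ⟨j, hj⟩
    have : ((j : ℕ) : ℝ) + 1 ≤ n := by exact_mod_cast j.2
    exact ⟨(Nat.cast_nonneg _).trans hj.1, hj.2.trans this⟩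
  · exact fun hs => exists_fin_mem_Icc hs hn

theorem tipToTailPath_fin {E : Type*} [AddCommGroup E] [Module ℝ E] {n : ℕ} (u : Fin n → E)
    (j : Fin n) : tipToTailPath u (j : ℕ) = tipToTail u j := by
  have := tipToTailPath_add u j (x := 0) (by simp)
  simpa [tipToTail_apply] using this

theorem tipToTailPath_fin_add_one {E : Type*} [AddCommGroup E] [Module ℝ E] {n : ℕ} (u : Fin n → E)
    (hu : ∑ i, u i = 0) (j : Fin n) :
    tipToTailPath u ((j : ℕ) + 1) = tipToTail u (finRotate n j) := by
  have := tipToTailPath_add u j (x := 1) (by simp)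
  rw [this, tipToTail_finRotate u hu, one_smul]
  rfl

/-- A closed polygonal path that is injective up to its endpoints is a simple polygon. -/
theorem isSimplePolygon_tipToTail {E : Type*} [AddCommGroup E] [Module ℝ E] {n : ℕ} (u : Fin n → E)
    (hu : ∑ i, u i = 0)
    (hinj : ∀ s ∈ Icc (0 : ℝ) n, ∀ s' ∈ Icc (0 : ℝ) n, s < s' →
      tipToTailPath u s = tipToTailPath u s' → s = 0 ∧ s' = n) :
    IsSimplePolygon (tipToTail u) := by
  have hcast : ∀ j : Fin n, ((j : ℕ) : ℝ) + 1 ≤ n := fun j => by exact_mod_cast j.2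
  have hnn : ∀ j : Fin n, (0 : ℝ) ≤ (j : ℕ) := fun j => Nat.cast_nonneg _
  have key : ∀ i j : Fin n, i < j → (tipToTail u).edgeSet ℝ i ∩ (tipToTail u).edgeSet ℝ j ⊆
      {tipToTail u i, tipToTail u (finRotate n i)} ∩
        {tipToTail u j, tipToTail u (finRotate n j)} := by
    intro i j hij p ⟨hi, hj⟩
    rw [edgeSet_tipToTail u hu] at hi hj
    obtain ⟨s, hs, rfl⟩ := hi
    obtain ⟨s', hs', heq⟩ := hj
    have hij' : ((i : ℕ) : ℝ) + 1 ≤ (j : ℕ) := by exact_mod_cast Nat.succ_le_of_lt (Fin.lt_def.1 hij)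
    have h1 := hcast i
    have h2 := hcast j
    have h3 := hnn i
    have h4 := hnn j
    -- Either the two edges meet at equal parameters, so they are consecutive and share that vertex,
    -- or the common point is the closing vertex.
    rcases (hs.2.trans (hij'.trans hs'.1)).eq_or_lt with h | h
    · have e1 : s = (i : ℕ) + 1 := by linarith [hs.2, hs'.1]
      have e2 : s = (j : ℕ) := by linarith [hs.2, hs'.1]
      constructor
      · right; rw [e1]; exact tipToTailPath_fin_add_one u hu i
      · left; rw [e2]; exact tipToTailPath_fin u j
    · obtain ⟨e1, e2⟩ := hinj s ⟨by linarith [hs.1], by linarith [hs.2]⟩ s'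
        ⟨by linarith [hs'.1], by linarith [hs'.2]⟩ h heq.symm
      constructor
      · left
        rw [← tipToTailPath_fin]
        congr 1
        linarith [hs.1]
      · right
        rw [mem_singleton_iff, ← heq, ← tipToTailPath_fin_add_one u hu]
        congr 1
        linarith [hs'.2]
  refine ⟨?_, ?_⟩
  · intro i j hij
    by_contra hne
    wlog h : i < j generalizing i j
    · exact this hij.symm (Ne.symm hne) (lt_of_le_of_ne (not_lt.1 h) (Ne.symm hne))
    have hij' : ((i : ℕ) : ℝ) + 1 ≤ (j : ℕ) := by exact_mod_cast Nat.succ_le_of_lt (Fin.lt_def.1 h)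
    have := hinj (i : ℕ) ⟨hnn i, by linarith [hcast i]⟩ (j : ℕ) ⟨hnn j, by linarith [hcast j]⟩
      (by linarith) (by rw [tipToTailPath_fin, tipToTailPath_fin]; exact hij)
    linarith [hcast j, this.2]
  · intro i j hij
    rcases lt_or_gt_of_ne hij with h | h
    · exact key i j h
    · rw [inter_comm, inter_comm {tipToTail u i, _}]
      exact key j i h

/-! ### Trigonometry of the regular pentagram -/

theorem tan_two_pi_div_five_pos : 0 < Real.tan (2 * Real.pi / 5) :=
  Real.tan_pos_of_pos_of_lt_pi_div_two (by linarith [Real.pi_pos]) (by linarith [Real.pi_pos])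

theorem arctan_tan_two_pi_div_five : Real.arctan (Real.tan (2 * Real.pi / 5)) = 2 * Real.pi / 5 :=
  Real.arctan_tan (by linarith [Real.pi_pos]) (by linarith [Real.pi_pos])

theorem cos_pi_div_five_pos : 0 < Real.cos (Real.pi / 5) :=
  Real.cos_pos_of_mem_Ioo ⟨by linarith [Real.pi_pos], by linarith [Real.pi_pos]⟩

theorem cos_two_pi_div_five_pos : 0 < Real.cos (2 * Real.pi / 5) :=
  Real.cos_pos_of_mem_Ioo ⟨by linarith [Real.pi_pos], by linarith [Real.pi_pos]⟩

/-- Locates the crossings of the pentagram. Seen from the centre, they lie at angle $\pi/5$ from the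
midpoint of a side, whose ends lie at $2\pi/5$. They therefore divide the side in the golden
section. -/
theorem tan_pi_div_five_eq :
    Real.tan (Real.pi / 5) = (Real.sqrt 5 - 2) * Real.tan (2 * Real.pi / 5) := by
  have h1 := cos_pi_div_five_pos
  have h2 := cos_two_pi_div_five_pos
  have h5 : Real.sqrt 5 ^ 2 = 5 := Real.sq_sqrt (by norm_num)
  rw [Real.tan_eq_sin_div_cos, Real.tan_eq_sin_div_cos, mul_div_assoc', div_eq_div_iff h1.ne' h2.ne']
  rw [mul_div_assoc, Real.cos_two_mul, Real.sin_two_mul, Real.cos_pi_div_five]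
  linear_combination Real.sin (Real.pi / 5) * ((1 - Real.sqrt 5) / 8) * h5

/-- The angle that a side of a pentagram has covered, seen from the centre, at the point that
divides the side in the ratio `y : (1 - y)`. -/
noncomputable def legAngle (y : ℝ) : ℝ :=
  2 * Real.pi / 5 + Real.arctan ((2 * y - 1) * Real.tan (2 * Real.pi / 5))

theorem continuous_legAngle : Continuous legAngle := by
  unfold legAngle
  exact continuous_const.add (Real.continuous_arctan.comp (by fun_prop))

theorem legAngle_zero : legAngle 0 = 0 := by
  rw [legAngle, show (2 * (0 : ℝ) - 1) * Real.tan (2 * Real.pi / 5) = -Real.tan (2 * Real.pi / 5) by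
    ring, Real.arctan_neg, arctan_tan_two_pi_div_five]
  ring

theorem legAngle_one : legAngle 1 = 4 * Real.pi / 5 := by
  rw [legAngle, show (2 * (1 : ℝ) - 1) * Real.tan (2 * Real.pi / 5) = Real.tan (2 * Real.pi / 5) by
    ring, arctan_tan_two_pi_div_five]
  ring

/-- The derivative $2T/(1+((2y-1)T)^2)$ is smallest at the two ends of the side. -/
theorem exists_legAngle_expanding : ∃ ω > 0, ∀ x ∈ Icc (0 : ℝ) 1, ∀ y ∈ Icc (0 : ℝ) 1, x ≤ y →
    ω * (y - x) ≤ legAngle y - legAngle x := by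
  set T := Real.tan (2 * Real.pi / 5) with hT
  have hT0 : 0 < T := tan_two_pi_div_five_pos
  have hd : ∀ y, HasDerivAt legAngle (1 / (1 + ((2 * y - 1) * T) ^ 2) * (2 * T)) y := by
    intro y
    have h1 : HasDerivAt (fun y : ℝ => (2 * y - 1) * T) (2 * T) y := by
      simpa using (((hasDerivAt_id y).const_mul 2).sub_const 1).mul_const T
    exact (h1.arctan).const_add _
  refine ⟨1 / (1 + T ^ 2) * (2 * T), by positivity, ?_⟩
  refine (convex_Icc 0 1).mul_sub_le_image_sub_of_le_deriv continuous_legAngle.continuousOn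
    (fun y _ => (hd y).differentiableAt.differentiableWithinAt) ?_
  intro y hy
  rw [interior_Icc] at hy
  rw [(hd y).deriv]
  have : ((2 * y - 1) * T) ^ 2 ≤ T ^ 2 := by
    rw [mul_pow]
    have : (2 * y - 1) ^ 2 ≤ 1 := by nlinarith [hy.1, hy.2]
    nlinarith [sq_nonneg T]
  gcongr

/-- The distance from the centre along a side of a pentagram, up to scale, as a function of the
product `y * (1 - y)` of the ratios in which the side is divided. -/
noncomputable def legRadius (b : ℝ) : ℝ :=
  Real.sqrt (1 + Real.tan (2 * Real.pi / 5) ^ 2 * (1 - 4 * b))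

theorem legRadius_mul (y : ℝ) : legRadius (y * (1 - y)) =
    Real.sqrt (1 + ((2 * y - 1) * Real.tan (2 * Real.pi / 5)) ^ 2) := by
  unfold legRadius
  congr 1
  ring

theorem continuous_legRadius : Continuous legRadius := by
  unfold legRadius
  fun_prop

theorem one_le_legRadius {b : ℝ} (hb : b ≤ 1 / 4) : 1 ≤ legRadius b := by
  rw [legRadius, Real.one_le_sqrt]
  nlinarith [sq_nonneg (Real.tan (2 * Real.pi / 5))]

/-- The squared radius is affine in $b$, and the factor `legRadius b + legRadius b'` in the
difference of squares is at least $1$. -/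
theorem abs_legRadius_sub_le {b b' : ℝ} (hb : b ≤ 1 / 4) (hb' : b' ≤ 1 / 4) :
    |legRadius b - legRadius b'| ≤ 4 * Real.tan (2 * Real.pi / 5) ^ 2 * |b - b'| := by
  have h1 := one_le_legRadius hb
  have h2 := one_le_legRadius hb'
  have e : ∀ {x : ℝ}, x ≤ 1 / 4 →
      legRadius x ^ 2 = 1 + Real.tan (2 * Real.pi / 5) ^ 2 * (1 - 4 * x) := by
    intro x hx
    exact Real.sq_sqrt (by nlinarith [sq_nonneg (Real.tan (2 * Real.pi / 5))])
  have h3 : |legRadius b - legRadius b'| * (legRadius b + legRadius b') =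
      4 * Real.tan (2 * Real.pi / 5) ^ 2 * |b - b'| := by
    rw [← abs_of_nonneg (by linarith : 0 ≤ legRadius b + legRadius b'), ← abs_mul,
      ← abs_of_nonneg (by positivity : 0 ≤ 4 * Real.tan (2 * Real.pi / 5) ^ 2), ← abs_mul,
      ← abs_neg]
    congr 1
    linear_combination e hb' - e hb
  rw [← h3]
  exact le_mul_of_one_le_right (abs_nonneg _) (by linarith)

/-- Polar coordinates of the points of the side of a pentagram whose midpoint has the direction
`B`. -/
theorem lerp_cos_eq_polar (R B y : ℝ) :
    R * Real.cos (B + 2 * Real.pi / 5) +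
        y * (R * Real.cos (B - 2 * Real.pi / 5) - R * Real.cos (B + 2 * Real.pi / 5)) =
      R * Real.cos (2 * Real.pi / 5) * legRadius (y * (1 - y)) *
        Real.cos (B + 2 * Real.pi / 5 - legAngle y) := by
  have hc := cos_two_pi_div_five_pos
  rw [legRadius_mul, legAngle]
  set v := (2 * y - 1) * Real.tan (2 * Real.pi / 5) with hv
  have hv' : v * Real.cos (2 * Real.pi / 5) = (2 * y - 1) * Real.sin (2 * Real.pi / 5) := by
    rw [hv, mul_assoc, Real.tan_mul_cos hc.ne']
  have hs : Real.sqrt (1 + v ^ 2) ≠ 0 := by positivity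
  rw [show B + 2 * Real.pi / 5 - (2 * Real.pi / 5 + Real.arctan v) = B - Real.arctan v by ring,
    Real.cos_sub B (Real.arctan v), Real.cos_arctan, Real.sin_arctan, Real.cos_add, Real.cos_sub]
  field_simp
  linear_combination (-R * Real.sin B) * hv'

theorem lerp_sin_eq_polar (R B y : ℝ) :
    R * Real.sin (B + 2 * Real.pi / 5) +
        y * (R * Real.sin (B - 2 * Real.pi / 5) - R * Real.sin (B + 2 * Real.pi / 5)) =
      R * Real.cos (2 * Real.pi / 5) * legRadius (y * (1 - y)) *
        Real.sin (B + 2 * Real.pi / 5 - legAngle y) := by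
  have h := lerp_cos_eq_polar R (B - Real.pi / 2) y
  rw [show B - Real.pi / 2 + 2 * Real.pi / 5 = B + 2 * Real.pi / 5 - Real.pi / 2 by ring,
    show B - Real.pi / 2 - 2 * Real.pi / 5 = B - 2 * Real.pi / 5 - Real.pi / 2 by ring,
    show B + 2 * Real.pi / 5 - Real.pi / 2 - legAngle y =
      B + 2 * Real.pi / 5 - legAngle y - Real.pi / 2 by ring] at h
  simpa only [Real.cos_sub_pi_div_two] using h

/-- An edge of the pentagon is a chord of angle $2\pi/5$, a side of the star one of angle $4\pi/5$.
The lengths agree for star radius $R/(2\cos(\pi/5))$, and the directions agree when $2j+4m$ is a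
multiple of $10$, that is, $j\equiv 3m \pmod 5$. -/
theorem cos_sub_cos_pentagon {R φ j m : ℝ} {k : ℤ} (h : 2 * j + 4 * m = 10 * k) :
    R * Real.cos (φ + 2 * Real.pi * (j + 1) / 5) - R * Real.cos (φ + 2 * Real.pi * j / 5) =
      R / (2 * Real.cos (Real.pi / 5)) * Real.cos (φ + 8 * Real.pi / 5 - 4 * Real.pi * (m + 1) / 5) -
      R / (2 * Real.cos (Real.pi / 5)) * Real.cos (φ + 8 * Real.pi / 5 - 4 * Real.pi * m / 5) := by
  have hc := cos_pi_div_five_pos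
  rw [← mul_sub, ← mul_sub, Real.cos_sub_cos, Real.cos_sub_cos]
  have e1 : (φ + 2 * Real.pi * (j + 1) / 5 + (φ + 2 * Real.pi * j / 5)) / 2 =
      φ + Real.pi / 5 - 4 * Real.pi * m / 5 + k * (2 * Real.pi) := by
    linear_combination Real.pi / 5 * h
  have e2 : (φ + 8 * Real.pi / 5 - 4 * Real.pi * (m + 1) / 5 +
      (φ + 8 * Real.pi / 5 - 4 * Real.pi * m / 5)) / 2 =
      φ + Real.pi / 5 - 4 * Real.pi * m / 5 + Real.pi := by ring
  have e3 : (φ + 2 * Real.pi * (j + 1) / 5 - (φ + 2 * Real.pi * j / 5)) / 2 = Real.pi / 5 := by ring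
  have e4 : (φ + 8 * Real.pi / 5 - 4 * Real.pi * (m + 1) / 5 -
      (φ + 8 * Real.pi / 5 - 4 * Real.pi * m / 5)) / 2 = -(2 * (Real.pi / 5)) := by ring
  rw [e1, e2, e3, e4, Real.sin_add_int_mul_two_pi, Real.sin_add_pi, Real.sin_neg, Real.sin_two_mul]
  field_simp

theorem sin_sub_sin_pentagon {R φ j m : ℝ} {k : ℤ} (h : 2 * j + 4 * m = 10 * k) :
    R * Real.sin (φ + 2 * Real.pi * (j + 1) / 5) - R * Real.sin (φ + 2 * Real.pi * j / 5) =
      R / (2 * Real.cos (Real.pi / 5)) * Real.sin (φ + 8 * Real.pi / 5 - 4 * Real.pi * (m + 1) / 5) -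
      R / (2 * Real.cos (Real.pi / 5)) * Real.sin (φ + 8 * Real.pi / 5 - 4 * Real.pi * m / 5) := by
  have h' := cos_sub_cos_pentagon (R := R) (φ := φ - Real.pi / 2) h
  have e : ∀ x, φ - Real.pi / 2 + x = φ + x - Real.pi / 2 := fun x => by ring
  have e' : ∀ x, φ + 8 * Real.pi / 5 - Real.pi / 2 - x = φ + 8 * Real.pi / 5 - x - Real.pi / 2 :=
    fun x => by ring
  simpa only [e, e', Real.cos_sub_pi_div_two] using h'

/-- Comparison of two points of a pentagram at opposite ends of a rotation by `2π/5`. -/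
theorem arctan_rotation_trichotomy {v v' : ℝ} (hv : -Real.tan (2 * Real.pi / 5) ≤ v)
    (hv' : v' ≤ Real.tan (2 * Real.pi / 5))
    (h : Real.arctan v' = Real.arctan v + 2 * Real.pi / 5) :
    (v' ^ 2 < v ^ 2 ∧ Real.cos (5 * Real.arctan v / 2) < 0) ∨
      (v ^ 2 < v' ^ 2 ∧ 0 < Real.cos (5 * Real.arctan v / 2)) ∨
      (v = -Real.tan (Real.pi / 5) ∧ v' = Real.tan (Real.pi / 5)) := by
  have hpi := Real.pi_pos
  have h1 : -(2 * Real.pi / 5) ≤ Real.arctan v := by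
    rw [← arctan_tan_two_pi_div_five, ← Real.arctan_neg]
    exact Real.arctan_strictMono.monotone hv
  have h2 : Real.arctan v' ≤ 2 * Real.pi / 5 := by
    rw [← arctan_tan_two_pi_div_five]
    exact Real.arctan_strictMono.monotone hv'
  have h3 : v ≤ 0 := by
    rw [← Real.arctan_strictMono.le_iff_le, Real.arctan_zero]; linarith
  have h4 : 0 ≤ v' := by
    rw [← Real.arctan_strictMono.le_iff_le, Real.arctan_zero]; linarith
  -- The symmetric position $v'=-v$ occurs at $\arctan v=-\pi/5$, exactly where $\cos(5\arctan v/2)$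
  -- changes sign.
  rcases lt_trichotomy (Real.arctan v) (-(Real.pi / 5)) with hx | hx | hx
  · left
    have h5 : v' < -v := by
      rw [← Real.arctan_strictMono.lt_iff_lt, Real.arctan_neg]; linarith
    refine ⟨by nlinarith, ?_⟩
    rw [← Real.cos_neg]
    exact Real.cos_neg_of_pi_div_two_lt_of_lt (by linarith) (by linarith)
  · right; right
    have h5 : Real.arctan v' = Real.pi / 5 := by linarith
    constructor
    · rw [← Real.tan_arctan v, hx, Real.tan_neg]
    · rw [← Real.tan_arctan v', h5]
  · right; left
    have h5 : -v < v' := by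
      rw [← Real.arctan_strictMono.lt_iff_lt, Real.arctan_neg]; linarith
    refine ⟨by nlinarith, ?_⟩
    exact Real.cos_pos_of_mem_Ioo ⟨by linarith, by linarith⟩

/-! ### Sums of ramps -/

theorem exists_fin_add_eq {n : ℕ} {s : ℝ} (hs : s ∈ Icc (0 : ℝ) n) (hn : 0 < n) :
    ∃ j : Fin n, ∃ x ∈ Icc (0 : ℝ) 1, s = (j : ℕ) + x := by
  obtain ⟨j, hj⟩ := exists_fin_mem_Icc hs hn
  exact ⟨j, s - (j : ℕ), ⟨by linarith [hj.1], by linarith [hj.2]⟩, by ring⟩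

theorem sum_ramp {n : ℕ} {s : ℝ} (hs : s ∈ Icc (0 : ℝ) n) (hn : 0 < n) :
    ∑ i : Fin n, ramp (s - (i : ℕ)) = s := by
  obtain ⟨j, x, hx, rfl⟩ := exists_fin_add_eq hs hn
  rw [sum_ramp_eq (fun _ y => y) (by simp) j hx]
  simp

theorem sum_comp_ramp_zero {n : ℕ} (f : Fin n → ℝ → ℝ) (hf : ∀ i, f i 0 = 0) :
    ∑ i : Fin n, f i (ramp (0 - (i : ℕ))) = 0 :=
  Finset.sum_eq_zero fun i _ => by rw [ramp_of_nonpos (by simp), hf]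

theorem sum_comp_ramp_last {n : ℕ} (f : Fin n → ℝ → ℝ) :
    ∑ i : Fin n, f i (ramp ((n : ℝ) - (i : ℕ))) = ∑ i, f i 1 :=
  Finset.sum_congr rfl fun i _ => by
    have : ((i : ℕ) : ℝ) + 1 ≤ n := by exact_mod_cast i.2
    rw [ramp_of_one_le (by linarith)]

/-- The ramps are monotone and add up to $s$, so a slope bound common to all pieces is a slope bound
for the sum. -/
theorem sum_comp_ramp_sub_le {n : ℕ} (f : Fin n → ℝ → ℝ) {μ : ℝ}
    (hf : ∀ i, ∀ x ∈ Icc (0 : ℝ) 1, ∀ y ∈ Icc (0 : ℝ) 1, x ≤ y → f i y - f i x ≤ μ * (y - x))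
    (hn : 0 < n) {s s' : ℝ} (hs : s ∈ Icc (0 : ℝ) n) (hs' : s' ∈ Icc (0 : ℝ) n) (h : s ≤ s') :
    ∑ i : Fin n, f i (ramp (s' - (i : ℕ))) - ∑ i : Fin n, f i (ramp (s - (i : ℕ))) ≤
      μ * (s' - s) := by
  calc _ = ∑ i : Fin n, (f i (ramp (s' - (i : ℕ))) - f i (ramp (s - (i : ℕ)))) := by
        rw [Finset.sum_sub_distrib]
    _ ≤ ∑ i : Fin n, μ * (ramp (s' - (i : ℕ)) - ramp (s - (i : ℕ))) :=
        Finset.sum_le_sum fun i _ => hf i _ (ramp_mem _) _ (ramp_mem _) (ramp_mono (by linarith))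
    _ = μ * (s' - s) := by
        rw [← Finset.mul_sum, Finset.sum_sub_distrib, sum_ramp hs hn, sum_ramp hs' hn]

theorem abs_sum_comp_ramp_sub_le {n : ℕ} (f : Fin n → ℝ → ℝ) {L : ℝ}
    (hf : ∀ i, ∀ x ∈ Icc (0 : ℝ) 1, ∀ y ∈ Icc (0 : ℝ) 1, |f i y - f i x| ≤ L * |y - x|)
    (hn : 0 < n) {s s' : ℝ} (hs : s ∈ Icc (0 : ℝ) n) (hs' : s' ∈ Icc (0 : ℝ) n) :
    |∑ i : Fin n, f i (ramp (s - (i : ℕ))) - ∑ i : Fin n, f i (ramp (s' - (i : ℕ)))| ≤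
      L * |s - s'| := by
  wlog h : s' ≤ s generalizing s s'
  · rw [abs_sub_comm, abs_sub_comm s]
    exact this hs' hs (le_of_not_ge h)
  rw [abs_of_nonneg (sub_nonneg.2 h), abs_le]
  constructor
  · have := sum_comp_ramp_sub_le (fun i x => -f i x) (μ := L) (fun i x hx y hy hxy => by
      have := neg_le_of_abs_le (hf i x hx y hy)
      rw [abs_of_nonneg (sub_nonneg.2 hxy)] at this
      linarith) hn hs' hs h
    simp only [Finset.sum_neg_distrib] at this
    linarith
  · exact sum_comp_ramp_sub_le f (fun i x hx y hy hxy => by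
      have := le_of_abs_le (hf i x hx y hy)
      rwa [abs_of_nonneg (sub_nonneg.2 hxy)] at this) hn hs' hs h

/-! ### The star with eight edges -/

/-- The five functions `G 0, …, G 4`, belonging to the sides of the star, with zeros inserted for
the vertical edges. -/
def insertVertical (G : Fin 5 → ℝ → ℝ) : Fin 8 → ℝ → ℝ :=
  ![G 0, G 1, 0, G 2, 0, G 3, 0, G 4]

theorem insertVertical_cases {p : (ℝ → ℝ) → Prop} {G : Fin 5 → ℝ → ℝ} (h : ∀ m, p (G m)) (h0 : p 0)
    (i : Fin 8) : p (insertVertical G i) := by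
  fin_cases i <;> simp [insertVertical, h, h0]

/-- The height increments along the eight edges of the star. -/
noncomputable def starSteps : Fin 8 → ℝ := ![-125, 100, 7, -50, 11, -50, 7, 100]

noncomputable def starHeight (s : ℝ) : ℝ := ∑ i : Fin 8, ramp (s - (i : ℕ)) * starSteps i

/-- A point of a vertical edge counts as the start $y=0$ of the next side, since only its height
distinguishes it. The height formula is therefore claimed only for interior $y$, which suffices
because crossings are not at corners. -/
theorem exists_leg {s : ℝ} (hs : s ∈ Icc (0 : ℝ) 8) : ∃ m : Fin 5, ∃ y ∈ Icc (0 : ℝ) 1,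
    (∀ G : Fin 5 → ℝ → ℝ, (∀ k, G k 0 = 0) →
      ∑ i : Fin 8, insertVertical G i (ramp (s - (i : ℕ))) =
        ∑ k ∈ Finset.Iio m, G k 1 + G m y) ∧
    (y ∈ Ioo (0 : ℝ) 1 → starHeight s = (![0, -125, -18, -57, -100] : Fin 5 → ℝ) m +
      y * (![-125, 100, -50, -50, 100] : Fin 5 → ℝ) m) := by
  obtain ⟨j, x, hx, rfl⟩ := exists_fin_add_eq (n := 8) (by simpa using hs) (by norm_num)
  have hH : starHeight ((j : ℕ) + x) = ∑ i, (if i < j then starSteps i else 0) + x * starSteps j := by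
    rw [starHeight, sum_ramp_eq (fun i y => y * starSteps i) (by simp) j hx, ← Finset.sum_filter]
    simp [Finset.filter_gt_eq_Iio]
  have hG : ∀ G : Fin 5 → ℝ → ℝ, (∀ k, G k 0 = 0) →
      ∑ i : Fin 8, insertVertical G i (ramp ((j : ℕ) + x - (i : ℕ))) =
        ∑ i, (if i < j then insertVertical G i 1 else 0) + insertVertical G j x := by
    intro G hG0
    rw [sum_ramp_eq _ (fun i => insertVertical_cases (p := fun g => g 0 = 0) hG0 rfl i) j hx,
      ← Finset.sum_filter, Finset.filter_gt_eq_Iio]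
  have hI : ∀ (G : Fin 5 → ℝ → ℝ) (m : Fin 5),
      ∑ k ∈ Finset.Iio m, G k 1 = ∑ k, if k < m then G k 1 else 0 := by
    intro G m
    rw [← Finset.sum_filter, Finset.filter_gt_eq_Iio]
  rw [hH]
  have h01 : (0 : ℝ) ∈ Icc (0 : ℝ) 1 := by simp
  fin_cases j
  · refine ⟨0, x, hx, fun G h0 => ?_, fun _ => ?_⟩
    · rw [hG G h0, hI]
      simp [insertVertical]
    · simp [starSteps]
  · refine ⟨1, x, hx, fun G h0 => ?_, fun _ => ?_⟩
    · rw [hG G h0, hI]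
      simp [insertVertical]
    · simp [starSteps]
  · refine ⟨2, 0, h01, fun G h0 => ?_, fun h => absurd h.1 (lt_irrefl _)⟩
    rw [hG G h0, hI, h0]
    simp [Fin.sum_univ_eight, Fin.sum_univ_five, insertVertical]
  · refine ⟨2, x, hx, fun G h0 => ?_, fun _ => ?_⟩
    · rw [hG G h0, hI]
      simp [Fin.sum_univ_eight, Fin.sum_univ_five, insertVertical]
    · simp [Fin.sum_univ_eight, starSteps]; norm_num
  · refine ⟨3, 0, h01, fun G h0 => ?_, fun h => absurd h.1 (lt_irrefl _)⟩
    rw [hG G h0, hI, h0]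
    simp [Fin.sum_univ_eight, Fin.sum_univ_five, insertVertical]
  · refine ⟨3, x, hx, fun G h0 => ?_, fun _ => ?_⟩
    · rw [hG G h0, hI]
      simp [Fin.sum_univ_eight, Fin.sum_univ_five, insertVertical]
    · simp [Fin.sum_univ_eight, starSteps]; norm_num
  · refine ⟨4, 0, h01, fun G h0 => ?_, fun h => absurd h.1 (lt_irrefl _)⟩
    rw [hG G h0, hI, h0]
    simp [Fin.sum_univ_eight, Fin.sum_univ_five, insertVertical]
  · refine ⟨4, x, hx, fun G h0 => ?_, fun _ => ?_⟩
    · rw [hG G h0, hI]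
      simp [Fin.sum_univ_eight, Fin.sum_univ_five, insertVertical]
    · simp [Fin.sum_univ_eight, starSteps]; norm_num

noncomputable def starAngle (s : ℝ) : ℝ :=
  ∑ i : Fin 8, insertVertical (fun _ y => -legAngle y) i (ramp (s - (i : ℕ)))

/-- Since $y(1-y)$ vanishes at both ends, finished sides contribute nothing and the sum is the value
on the current side alone. -/
noncomputable def starRatio (s : ℝ) : ℝ :=
  ∑ i : Fin 8, insertVertical (fun _ y => y * (1 - y)) i (ramp (s - (i : ℕ)))

theorem exists_leg_angle {s : ℝ} (hs : s ∈ Icc (0 : ℝ) 8) : ∃ m : Fin 5, ∃ y ∈ Icc (0 : ℝ) 1,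
    starAngle s = -(4 * Real.pi * (m : ℕ) / 5 + legAngle y) ∧ starRatio s = y * (1 - y) ∧
    (∀ P : ℕ → ℝ, P 0 + ∑ i : Fin 8, insertVertical (fun k y => y * (P (k + 1) - P k)) i
      (ramp (s - (i : ℕ))) = P m + y * (P (m + 1) - P m)) ∧
    (y ∈ Ioo (0 : ℝ) 1 → starHeight s = (![0, -125, -18, -57, -100] : Fin 5 → ℝ) m +
      y * (![-125, 100, -50, -50, 100] : Fin 5 → ℝ) m) := by
  obtain ⟨m, y, hy, hG, hH⟩ := exists_leg hs
  refine ⟨m, y, hy, ?_, ?_, ?_, hH⟩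
  · rw [starAngle, hG _ (by simp [legAngle_zero]), legAngle_one]
    simp
    ring
  · rw [starRatio, hG _ (by simp)]
    simp
  · intro P
    rw [hG _ (by simp)]
    fin_cases m <;> simp [← Finset.filter_gt_eq_Iio, Finset.sum_filter, Fin.sum_univ_five] <;> ring

theorem starRatio_le {s : ℝ} (hs : s ∈ Icc (0 : ℝ) 8) : starRatio s ≤ 1 / 4 := by
  obtain ⟨m, y, hy, -, h, -⟩ := exists_leg_angle hs
  rw [h]
  nlinarith [sq_nonneg (2 * y - 1)]

/-- Where two strands of the star have the same direction from the centre, their distances from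
the centre are ordered as in the standard position of `5₁`, and at a crossing their heights are
ordered alternatingly. -/
theorem star_crossing {s s' : ℝ} (hs : s ∈ Icc (0 : ℝ) 8) (hs' : s' ∈ Icc (0 : ℝ) 8)
    (h : starAngle s - starAngle s' = 2 * Real.pi) :
    (starRatio s < starRatio s' ∧ 0 < Real.cos (5 * starAngle s / 2)) ∨
      (starRatio s' < starRatio s ∧ Real.cos (5 * starAngle s / 2) < 0) ∨
      (starRatio s = starRatio s' ∧ Real.cos (5 * starAngle s / 2) = 0 ∧
        Real.sin (5 * starAngle s / 2) * (starHeight s - starHeight s') < 0) := by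
  have hpi := Real.pi_pos
  obtain ⟨m, y, hy, hA, hb, -, hH⟩ := exists_leg_angle hs
  obtain ⟨m', y', hy', hA', hb', -, hH'⟩ := exists_leg_angle hs'
  set T := Real.tan (2 * Real.pi / 5) with hT
  have hT0 : 0 < T := tan_two_pi_div_five_pos
  set v := (2 * y - 1) * T with hv
  set v' := (2 * y' - 1) * T with hv'
  have hvT : -T ≤ v ∧ v ≤ T := ⟨by nlinarith [hy.1], by nlinarith [hy.2]⟩
  have hvT' : -T ≤ v' ∧ v' ≤ T := ⟨by nlinarith [hy'.1], by nlinarith [hy'.2]⟩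
  have hbv : ∀ {z z' : ℝ}, ((2 * z - 1) * T) ^ 2 < ((2 * z' - 1) * T) ^ 2 →
      z' * (1 - z') < z * (1 - z) := by
    intro z z' hz
    rw [mul_pow, mul_pow] at hz
    have := lt_of_mul_lt_mul_right hz (sq_nonneg T)
    linarith
  have hm : starAngle s = -(4 * Real.pi * (m : ℕ) / 5 + 2 * Real.pi / 5 + Real.arctan v) := by
    rw [hA, legAngle]; ring
  have hm' : starAngle s' = -(4 * Real.pi * (m' : ℕ) / 5 + 2 * Real.pi / 5 + Real.arctan v') := by
    rw [hA', legAngle]; ring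
  have hbd : ∀ {x : ℝ}, -T ≤ x ∧ x ≤ T → -(2 * Real.pi / 5) ≤ Real.arctan x ∧
      Real.arctan x ≤ 2 * Real.pi / 5 := by
    intro x hx
    rw [← arctan_tan_two_pi_div_five, ← Real.arctan_neg]
    exact ⟨Real.arctan_strictMono.monotone hx.1, Real.arctan_strictMono.monotone hx.2⟩
  -- Both arctangents are at most $2\pi/5$ in absolute value, so $m'-m$ differs from $5/2$ by at
  -- most $1$.
  have hd : (m' : ℕ) = (m : ℕ) + 2 ∨ (m' : ℕ) = (m : ℕ) + 3 := by
    have b1 := hbd hvT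
    have b2 := hbd hvT'
    have h1 : (3 / 2 : ℝ) * Real.pi ≤ (((m' : ℕ) : ℝ) - (m : ℕ)) * Real.pi := by
      rw [hm, hm'] at h; linarith
    have h2 : (((m' : ℕ) : ℝ) - (m : ℕ)) * Real.pi ≤ (7 / 2 : ℝ) * Real.pi := by
      rw [hm, hm'] at h; linarith
    have h3 := le_of_mul_le_mul_right h1 hpi
    have h4 := le_of_mul_le_mul_right h2 hpi
    have h5 : ((m : ℕ) : ℝ) + 1 < (m' : ℕ) := by linarith
    have h6 : ((m' : ℕ) : ℝ) < (m : ℕ) + 4 := by linarith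
    have h5' : (m : ℕ) + 1 < m' := by exact_mod_cast h5
    have h6' : (m' : ℕ) < m + 4 := by exact_mod_cast h6
    omega
  have hcos : Real.cos (5 * starAngle s / 2) = -Real.cos (5 * Real.arctan v / 2) := by
    rw [hm, show 5 * -(4 * Real.pi * (m : ℕ) / 5 + 2 * Real.pi / 5 + Real.arctan v) / 2 =
      -(5 * Real.arctan v / 2 + Real.pi + (m : ℕ) * (2 * Real.pi)) by ring, Real.cos_neg,
      Real.cos_add_nat_mul_two_pi, Real.cos_add_pi]
  have hsin : Real.sin (5 * starAngle s / 2) = Real.sin (5 * Real.arctan v / 2) := by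
    rw [hm, show 5 * -(4 * Real.pi * (m : ℕ) / 5 + 2 * Real.pi / 5 + Real.arctan v) / 2 =
      -(5 * Real.arctan v / 2 + Real.pi + (m : ℕ) * (2 * Real.pi)) by ring, Real.sin_neg,
      Real.sin_add_nat_mul_two_pi, Real.sin_add_pi, neg_neg]
  have hat : Real.arctan (Real.tan (Real.pi / 5)) = Real.pi / 5 :=
    Real.arctan_tan (by linarith) (by linarith)
  have hhalf : 5 * (Real.pi / 5) / 2 = Real.pi / 2 := by ring
  have h5 : Real.sqrt 5 ^ 2 = 5 := Real.sq_sqrt (by norm_num)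
  have h5a : (2.236 : ℝ) < Real.sqrt 5 := Real.lt_sqrt_of_sq_lt (by norm_num)
  have h5b : Real.sqrt 5 < 2.237 := (Real.sqrt_lt' (by norm_num)).2 (by norm_num)
  have hyv : ∀ {z : ℝ}, (2 * z - 1) * T = -Real.tan (Real.pi / 5) → z = (3 - Real.sqrt 5) / 2 := by
    intro z hz
    rw [tan_pi_div_five_eq, ← neg_mul] at hz
    have := mul_right_cancel₀ hT0.ne' hz
    linarith
  have hyv' : ∀ {z : ℝ}, (2 * z - 1) * T = Real.tan (Real.pi / 5) → z = (Real.sqrt 5 - 1) / 2 := by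
    intro z hz
    rw [tan_pi_div_five_eq] at hz
    have := mul_right_cancel₀ hT0.ne' hz
    linarith
  rw [hcos, hsin, hb, hb']
  rcases hd with hd | hd
  · have e : Real.arctan v' = Real.arctan v + 2 * Real.pi / 5 := by
      rw [hm, hm', hd] at h
      push_cast at h
      linarith
    rcases arctan_rotation_trichotomy hvT.1 hvT'.2 e with ⟨h1, h2⟩ | ⟨h1, h2⟩ | ⟨h1, h2⟩
    · exact Or.inl ⟨hbv h1, by linarith⟩
    · exact Or.inr (Or.inl ⟨hbv h1, by linarith⟩)
    · have y1 := hyv h1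
      have y2 := hyv' h2
      refine Or.inr (Or.inr ⟨by rw [y1, y2]; ring, ?_, ?_⟩)
      · rw [h1, Real.arctan_neg, hat, mul_neg, neg_div, Real.cos_neg, hhalf, Real.cos_pi_div_two,
          neg_zero]
      · rw [h1, Real.arctan_neg, hat, mul_neg, neg_div, Real.sin_neg, hhalf, Real.sin_pi_div_two,
          hH ⟨by linarith, by linarith⟩, hH' ⟨by linarith, by linarith⟩, y1, y2]
        clear_value T
        clear hm hm' hA hA' h hcos hsin
        -- Three crossings have $m'=m+2$. The strand through $s$ must have the larger `starHeight`;
        -- the gaps are between $1$ and $1.5$, which the decimal bounds on $\sqrt5$ resolve.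
        fin_cases m <;> fin_cases m' <;> simp at hd <;> simp <;> linarith
  -- The case $m'=m+3$ is the mirror image under $v\mapsto -v$. The cosine is unchanged, the sine
  -- changes sign, and the required order of heights at the two crossings is reversed.
  · have e : Real.arctan (-v') = Real.arctan (-v) + 2 * Real.pi / 5 := by
      rw [Real.arctan_neg, Real.arctan_neg]
      rw [hm, hm', hd] at h
      push_cast at h
      linarith
    have hc : Real.cos (5 * Real.arctan (-v) / 2) = Real.cos (5 * Real.arctan v / 2) := by
      rw [Real.arctan_neg, mul_neg, neg_div, Real.cos_neg]
    have := arctan_rotation_trichotomy (v := -v) (v' := -v') (by linarith [hvT.2])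
      (by linarith [hvT'.1]) e
    rw [hc, neg_sq, neg_sq] at this
    rcases this with ⟨h1, h2⟩ | ⟨h1, h2⟩ | ⟨h1, h2⟩
    · exact Or.inl ⟨hbv h1, by linarith⟩
    · exact Or.inr (Or.inl ⟨hbv h1, by linarith⟩)
    · rw [neg_inj] at h1
      rw [neg_eq_iff_eq_neg] at h2
      have y1 := hyv' h1
      have y2 := hyv h2
      refine Or.inr (Or.inr ⟨by rw [y1, y2]; ring, ?_, ?_⟩)
      · rw [h1, hat, hhalf, Real.cos_pi_div_two, neg_zero]
      · rw [h1, hat, hhalf, Real.sin_pi_div_two,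
          hH ⟨by linarith, by linarith⟩, hH' ⟨by linarith, by linarith⟩, y1, y2]
        clear hm hm' hA hA' h hcos hsin
        fin_cases m <;> fin_cases m' <;> simp at hd <;> simp <;> linarith

theorem continuous_starAngle : Continuous starAngle := by
  refine continuous_finsetSum _ fun i _ => ?_
  exact (insertVertical_cases (p := Continuous) (fun _ => continuous_legAngle.neg)
    continuous_const i).comp (continuous_ramp.comp (by fun_prop))

theorem continuous_starRatio : Continuous starRatio := by
  refine continuous_finsetSum _ fun i _ => ?_
  exact (insertVertical_cases (p := Continuous) (fun _ => by fun_prop)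
    continuous_const i).comp (continuous_ramp.comp (by fun_prop))

theorem continuous_starHeight : Continuous starHeight := by
  refine continuous_finsetSum _ fun i _ => ?_
  exact (continuous_ramp.comp (by fun_prop)).mul continuous_const

theorem starAngle_zero : starAngle 0 = 0 :=
  sum_comp_ramp_zero _ (insertVertical_cases (p := fun g => g 0 = 0) (by simp [legAngle_zero]) rfl)

theorem starRatio_zero : starRatio 0 = 0 :=
  sum_comp_ramp_zero _ (insertVertical_cases (p := fun g => g 0 = 0) (by simp) rfl)

theorem starHeight_zero : starHeight 0 = 0 :=
  sum_comp_ramp_zero (fun i y => y * starSteps i) (by simp)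

theorem starAngle_eight : starAngle 8 = -(4 * Real.pi) := by
  have h := sum_comp_ramp_last (n := 8) (insertVertical fun _ y => -legAngle y)
  rw [starAngle]
  push_cast at h
  rw [h]
  simp [Fin.sum_univ_eight, insertVertical, legAngle_one]
  ring

theorem starRatio_eight : starRatio 8 = 0 := by
  have h := sum_comp_ramp_last (n := 8) (insertVertical fun _ y => y * (1 - y))
  rw [starRatio]
  push_cast at h
  rw [h]
  simp [Fin.sum_univ_eight, insertVertical]

theorem sum_starSteps : ∑ i, starSteps i = 0 := by
  simp [Fin.sum_univ_eight, starSteps]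
  norm_num

theorem starHeight_eight : starHeight 8 = 0 := by
  have h := sum_comp_ramp_last (n := 8) (fun i y => y * starSteps i)
  rw [starHeight]
  push_cast at h
  rw [h]
  simpa using sum_starSteps

/-- For small `κ > 0` the angle `starAngle - κ * starHeight` decreases strictly along the star. -/
theorem exists_starAngle_sub_strictAnti : ∃ κ₀ > 0, ∀ κ, 0 < κ → κ ≤ κ₀ → ∃ μ > 0,
    ∀ s ∈ Icc (0 : ℝ) 8, ∀ s' ∈ Icc (0 : ℝ) 8, s ≤ s' →
      μ * (s' - s) ≤ (starAngle s - κ * starHeight s) - (starAngle s' - κ * starHeight s') := by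
  obtain ⟨ω, hω, hW⟩ := exists_legAngle_expanding
  -- On a side the height slope is at most $125$ in absolute value, so the twist uses up at most
  -- half of the angular speed $\omega$. On a vertical edge only the twist acts, and the smallest
  -- increment there is $7$.
  refine ⟨ω / 250, by positivity, fun κ hκ hκ' => ⟨min (ω / 2) (7 * κ), by positivity, ?_⟩⟩
  intro s hs s' hs' h
  have key := sum_comp_ramp_sub_le (n := 8)
    (fun i y => insertVertical (fun _ y => -legAngle y) i y - κ * (y * starSteps i))
    (μ := -min (ω / 2) (7 * κ)) (fun i x hx y hy hxy => ?_) (by norm_num)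
    (by simpa using hs) (by simpa using hs') h
  · simp only [Finset.sum_sub_distrib, ← Finset.mul_sum] at key
    change starAngle s' - κ * starHeight s' - (starAngle s - κ * starHeight s) ≤ _ at key
    linarith
  · have h1 := hW x hx y hy hxy
    have h2 : min (ω / 2) (7 * κ) * (y - x) ≤ ω / 2 * (y - x) :=
      mul_le_mul_of_nonneg_right (min_le_left _ _) (sub_nonneg.2 hxy)
    have h3 : min (ω / 2) (7 * κ) * (y - x) ≤ 7 * κ * (y - x) :=
      mul_le_mul_of_nonneg_right (min_le_right _ _) (sub_nonneg.2 hxy)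
    have h4 : κ * (y - x) ≤ ω / 250 * (y - x) :=
      mul_le_mul_of_nonneg_right hκ' (sub_nonneg.2 hxy)
    have h5 : 0 ≤ κ * (y - x) := mul_nonneg hκ.le (sub_nonneg.2 hxy)
    fin_cases i <;> simp [insertVertical, starSteps] <;> linarith

/-- The differences of the strands of the twisted star and of the standard position of `5₁` are
nowhere opposite if the twist is small. -/
theorem eventually_star_not_opposite (d : ℝ) (hd : 0 < d) (ε : ℝ) (hε : ε = 1 ∨ ε = -1) :
    ∀ᶠ κ in 𝓝 (0 : ℝ), ∀ p ∈ Icc (0 : ℝ) 1 ×ˢ Icc (0 : ℝ) 8 ×ˢ Icc (0 : ℝ) 8,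
      0 < |starAngle p.2.1 - κ * starHeight p.2.1 - (starAngle p.2.2 - κ * starHeight p.2.2)
          - 2 * Real.pi| +
        |(1 - p.1) * (d * legRadius (starRatio p.2.1) - d * legRadius (starRatio p.2.2)) +
          p.1 * (2 * Real.cos (5 * (starAngle p.2.1 - κ * starHeight p.2.1) / 2))| +
        |(1 - p.1) * (-ε * starHeight p.2.1 - -ε * starHeight p.2.2) +
          p.1 * (ε * (2 * Real.sin (5 * (starAngle p.2.1 - κ * starHeight p.2.1) / 2)))| := by
  have hA := continuous_starAngle
  have hB := continuous_starRatio
  have hH := continuous_starHeight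
  have hL := continuous_legRadius
  -- Positivity of the sum of absolute values is an open condition on $\kappa$ and the point
  -- jointly, so compactness reduces the claim to $\kappa=0$.
  refine IsCompact.eventually_forall_of_forall_eventually
    (isCompact_Icc.prod (isCompact_Icc.prod isCompact_Icc)) ?_
  rintro ⟨t, s, s'⟩ ⟨ht, hs, hs'⟩
  replace ht : t ∈ Icc (0 : ℝ) 1 := ht
  refine ContinuousAt.eventually_lt continuousAt_const (Continuous.continuousAt ?_) ?_
  · fun_prop
  · simp only [zero_mul, sub_zero]
    by_contra hcon
    have n1 := abs_nonneg (starAngle s - starAngle s' - 2 * Real.pi)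
    have n2 := abs_nonneg ((1 - t) * (d * legRadius (starRatio s) - d * legRadius (starRatio s')) +
      t * (2 * Real.cos (5 * starAngle s / 2)))
    have n3 := abs_nonneg ((1 - t) * (-ε * starHeight s - -ε * starHeight s') +
      t * (ε * (2 * Real.sin (5 * starAngle s / 2))))
    have z1 := abs_eq_zero.1 (le_antisymm (by linarith) n1)
    have z2 := abs_eq_zero.1 (le_antisymm (by linarith) n2)
    have z3 := abs_eq_zero.1 (le_antisymm (by linarith) n3)
    have hr : ∀ {b b' : ℝ}, b' ≤ 1 / 4 → b < b' → d * legRadius b' < d * legRadius b := by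
      intro b b' hb hbb
      have hT := tan_two_pi_div_five_pos
      refine mul_lt_mul_of_pos_left (Real.sqrt_lt_sqrt ?_ ?_) hd <;> nlinarith [sq_pos_of_pos hT]
    have conv_pos : ∀ {a b : ℝ}, 0 < a → 0 < b → 0 < (1 - t) * a + t * b := by
      intro a b ha hb
      rcases ht.1.eq_or_lt with h0 | h0
      · rw [← h0]; simpa using ha
      · exact add_pos_of_nonneg_of_pos (mul_nonneg (sub_nonneg.2 ht.2) ha.le) (mul_pos h0 hb)
    rcases star_crossing hs hs' (by linarith) with ⟨h1, h2⟩ | ⟨h1, h2⟩ | ⟨-, -, h3⟩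
    · have := conv_pos (sub_pos.2 (hr (starRatio_le hs') h1)) (mul_pos two_pos h2)
      linarith
    · have := conv_pos (sub_pos.2 (hr (starRatio_le hs) h1)) (mul_pos two_pos (neg_pos.2 h2))
      linarith
    -- At a crossing, pairing the height equation with $\varepsilon S$ removes $\varepsilon$ and
    -- leaves a convex combination of two positive numbers.
    · set S := Real.sin (5 * starAngle s / 2)
      have hS : S ≠ 0 := fun h => by simp [h] at h3
      have z4 : (1 - t) * (-(S * (starHeight s - starHeight s'))) + t * (2 * S ^ 2) = 0 := by
        have hε2 : ε * ε = 1 := by rcases hε with rfl | rfl <;> norm_num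
        have := congrArg (fun x => ε * S * x) z3
        simp only [mul_zero] at this
        linear_combination this + ((1 - t) * (S * (starHeight s - starHeight s')) -
          t * (2 * S ^ 2)) * hε2
      exact (conv_pos (neg_pos.2 h3) (by positivity)).ne' z4

theorem exists_abs_starRatio_sub_le : ∃ L, 0 ≤ L ∧ ∀ s ∈ Icc (0 : ℝ) 8, ∀ s' ∈ Icc (0 : ℝ) 8,
    |starRatio s - starRatio s'| ≤ L * |s - s'| := by
  refine ⟨1, zero_le_one, fun s hs s' hs' => abs_sum_comp_ramp_sub_le (n := 8) _ ?_ (by norm_num)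
    (by simpa using hs) (by simpa using hs')⟩
  intro i x hx y hy
  refine insertVertical_cases (p := fun g => |g y - g x| ≤ 1 * |y - x|) (fun _ => ?_) (by simp) i
  rw [show y * (1 - y) - x * (1 - x) = (1 - x - y) * (y - x) by ring, abs_mul]
  gcongr
  rw [abs_le]
  constructor <;> linarith [hx.1, hx.2, hy.1, hy.2]

theorem exists_abs_starHeight_sub_le : ∃ L, 0 ≤ L ∧ ∀ s ∈ Icc (0 : ℝ) 8, ∀ s' ∈ Icc (0 : ℝ) 8,
    |starHeight s - starHeight s'| ≤ L * |s - s'| := by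
  refine ⟨125, by norm_num, fun s hs s' hs' => abs_sum_comp_ramp_sub_le (n := 8)
    (fun i y => y * starSteps i) ?_ (by norm_num) (by simpa using hs) (by simpa using hs')⟩
  intro i x _ y _
  rw [← sub_mul, abs_mul, mul_comm]
  gcongr
  fin_cases i <;> simp [starSteps] <;> norm_num

/-- A closed path in `ℝ³` that a helical homeomorphism puts into the form of the twisted star is
injective up to its endpoints, and its image is ambient isotopic to `5₁`. -/
theorem star_injective_and_isotopic {d ε c₀ c₁ α : ℝ} (hd : 0 < d) (hε : ε = 1 ∨ ε = -1)
    {γ : ℝ → EuclideanSpace ℝ (Fin 3)}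
    (hγ : ∀ κ, ∀ s ∈ Icc (0 : ℝ) 8, helicalHomeomorph c₀ c₁ α (ε * κ) (γ s) =
      cylPoint (d * legRadius (starRatio s)) (starAngle s - κ * starHeight s)
        (-ε * starHeight s)) :
    (∀ s ∈ Icc (0 : ℝ) 8, ∀ s' ∈ Icc (0 : ℝ) 8, s < s' → γ s = γ s' → s = 0 ∧ s' = 8) ∧
      AmbientIsotopic (γ '' Icc (0 : ℝ) 8) (fiveOneKnot ε) := by
  have hpi := Real.pi_pos
  have h08 : (0 : ℝ) ≤ 8 := by norm_num
  have hm0 : (0 : ℝ) ∈ Icc (0 : ℝ) 8 := ⟨le_rfl, h08⟩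
  have hm8 : (8 : ℝ) ∈ Icc (0 : ℝ) 8 := ⟨h08, le_rfl⟩
  obtain ⟨κ₀, hκ₀, hanti⟩ := exists_starAngle_sub_strictAnti
  obtain ⟨δ, hδ, hopp⟩ := Metric.eventually_nhds_iff.1 (eventually_star_not_opposite d hd ε hε)
  obtain ⟨κ, hκ, hκ₀', hκδ⟩ : ∃ κ : ℝ, 0 < κ ∧ κ ≤ κ₀ ∧ κ < δ :=
    ⟨min κ₀ (δ / 2), by positivity, min_le_left _ _, (min_le_right _ _).trans_lt (half_lt_self hδ)⟩
  obtain ⟨μ, hμ, hmono⟩ := hanti κ hκ hκ₀'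
  replace hopp := hopp (y := κ) (by rwa [Real.dist_eq, sub_zero, abs_of_pos hκ])
  replace hγ := hγ κ
  set Θ : ℝ → ℝ := fun s => starAngle s - κ * starHeight s with hΘ
  set r : ℝ → ℝ := fun s => d * legRadius (starRatio s) with hr
  set z : ℝ → ℝ := fun s => -ε * starHeight s with hz
  have hv : ∀ t ∈ Icc (0 : ℝ) 1, ∀ s ∈ Icc (0 : ℝ) 8, ∀ s' ∈ Icc (0 : ℝ) 8,
      Θ s - Θ s' = 2 * Real.pi →
      (1 - t) * (r s - r s') + t * (2 * Real.cos (5 * Θ s / 2)) = 0 →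
      (1 - t) * (z s - z s') + t * (ε * (2 * Real.sin (5 * Θ s / 2))) = 0 → False := by
    intro t ht s hs s' hs' h1 h2 h3
    have := hopp (t, s, s') ⟨ht, hs, hs'⟩
    simp only [hΘ, hr, hz] at h1 h2 h3
    simp only [h2, h3, sub_eq_zero.2 h1, abs_zero, add_zero, lt_irrefl] at this
  have hr0 : ∀ s ∈ Icc (0 : ℝ) 8, 0 < r s := fun s hs =>
    mul_pos hd (zero_lt_one.trans_le (one_le_legRadius (starRatio_le hs)))
  have hΘ0 : Θ 0 = 0 := by simp [hΘ, starAngle_zero, starHeight_zero]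
  have hΘ8 : Θ 8 = -(4 * Real.pi) := by simp [hΘ, starAngle_eight, starHeight_eight]
  have hanti' : ∀ s ∈ Icc (0 : ℝ) 8, ∀ s' ∈ Icc (0 : ℝ) 8, s ≤ s' → μ * (s' - s) ≤ Θ s - Θ s' :=
    hmono
  have hΘmem : ∀ s ∈ Icc (0 : ℝ) 8, Θ s ∈ Icc (-(4 * Real.pi)) 0 := by
    intro s hs
    have h1 := hanti' 0 hm0 s hs hs.1
    have h2 := hanti' s hs 8 hm8 hs.2
    have h3 : 0 ≤ μ * (s - 0) := mul_nonneg hμ.le (by linarith [hs.1])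
    have h4 : 0 ≤ μ * (8 - s) := mul_nonneg hμ.le (by linarith [hs.2])
    constructor <;> linarith
  have hexp : ∀ s ∈ Icc (0 : ℝ) 8, ∀ s' ∈ Icc (0 : ℝ) 8, |s - s'| ≤ 1 / μ * |Θ s - Θ s'| := by
    intro s hs s' hs'
    wlog h : s ≤ s' generalizing s s'
    · rw [abs_sub_comm, abs_sub_comm (Θ s)]
      exact this s' hs' s hs (le_of_not_ge h)
    have h1 := hanti' s hs s' hs' h
    rw [abs_sub_comm, abs_of_nonneg (sub_nonneg.2 h), one_div, ← div_eq_inv_mul, le_div_iff₀ hμ]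
    linarith [le_abs_self (Θ s - Θ s')]
  refine ⟨?_, ?_⟩
  · intro s hs s' hs' hlt heq
    have h1 := congrArg (helicalHomeomorph c₀ c₁ α (ε * κ)) heq
    rw [hγ s hs, hγ s' hs', cylPoint_eq_iff (hr0 s hs) (hr0 s' hs')] at h1
    obtain ⟨hrr, hsin, hzz⟩ := h1
    have hpos : 0 < Θ s - Θ s' :=
      (mul_pos hμ (sub_pos.2 hlt)).trans_le (hanti' s hs s' hs' hlt.le)
    have hle : Θ s - Θ s' ≤ 4 * Real.pi := by linarith [(hΘmem s hs).2, (hΘmem s' hs').1]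
    obtain ⟨n, hn⟩ := Real.sin_eq_zero_iff.1 hsin
    change (n : ℝ) * Real.pi = (Θ s - Θ s') / 2 at hn
    have hn0 : (0 : ℝ) < n := pos_of_mul_pos_left (b := Real.pi) (by linarith) hpi.le
    have hn2 : (n : ℝ) ≤ 2 := le_of_mul_le_mul_right (by linarith) hpi
    have hn0' : 0 < n := by exact_mod_cast hn0
    have hn2' : n ≤ 2 := by exact_mod_cast hn2
    obtain rfl | rfl : n = 1 ∨ n = 2 := by omega
    -- A coincidence at angle difference $2\pi$ is the case $t=0$ of non-oppositeness.
    · push_cast at hn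
      refine (hv 0 (by simp) s hs s' hs' (by linarith) ?_ ?_).elim
      · rw [show r s = r s' from hrr]; ring
      · rw [show z s = z s' from hzz]; ring
    -- A difference of $4\pi$ uses up the whole range of $\Theta$, and strict monotonicity leaves
    -- only the two endpoints.
    · push_cast at hn
      have h2 := hanti' 0 hm0 s hs hs.1
      have h3 := hanti' s' hs' 8 hm8 hs'.2
      have h4 : 0 ≤ μ * (s - 0) := mul_nonneg hμ.le (by linarith [hs.1])
      have h5 : 0 ≤ μ * (8 - s') := mul_nonneg hμ.le (by linarith [hs'.2])
      have h6 : μ * (s - 0) = 0 := by linarith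
      have h7 : μ * (8 - s') = 0 := by linarith
      have h8 := (mul_eq_zero.1 h6).resolve_left hμ.ne'
      have h9 := (mul_eq_zero.1 h7).resolve_left hμ.ne'
      constructor <;> linarith
  · refine (ambientIsotopic_image_helicalHomeomorph c₀ c₁ α (ε * κ) _).trans ?_
    have himg : helicalHomeomorph c₀ c₁ α (ε * κ) '' (γ '' Icc (0 : ℝ) 8) =
        range fun s : Icc (0 : ℝ) 8 => cylPoint (r s) (Θ s) (z s) := by
      rw [image_image, image_congr hγ, image_eq_range]
    rw [himg]
    obtain ⟨L₁, hL₁, hlip₁⟩ := exists_abs_starRatio_sub_le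
    obtain ⟨L₂, hL₂, hlip₂⟩ := exists_abs_starHeight_sub_le
    set M := d * (4 * Real.tan (2 * Real.pi / 5) ^ 2 * L₁) + |ε| * L₂ with hM
    have hA := continuous_starAngle
    have hB := continuous_starRatio
    have hH := continuous_starHeight
    have hLc := continuous_legRadius
    have : PreconnectedSpace (Icc (0 : ℝ) 8) := Subtype.preconnectedSpace isPreconnected_Icc
    have toM : ∀ {x N : ℝ} {s s' : ℝ}, s ∈ Icc (0 : ℝ) 8 → s' ∈ Icc (0 : ℝ) 8 →
        x ≤ N * |s - s'| → N ≤ M → x ≤ M * (1 / μ) * |Θ s - Θ s'| := by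
      intro x N s s' hs hs' h1 h2
      calc x ≤ N * |s - s'| := h1
        _ ≤ M * |s - s'| := by gcongr
        _ ≤ M * (1 / μ * |Θ s - Θ s'|) := by
            gcongr
            exact hexp s hs s' hs'
        _ = _ := by ring
    refine ambientIsotopic_fiveOneKnot_of_braid (S := Icc (0 : ℝ) 8) (Θ := fun s => Θ s)
      (r := fun s => r s) (z := fun s => z s) (a := ⟨0, hm0⟩) (b := ⟨8, hm8⟩) (L := M * (1 / μ))
      (by fun_prop) (by fun_prop) (by fun_prop) (fun s => hΘmem s s.2) hΘ0 hΘ8 ?_ ?_ ?_ ?_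
      (fun s => hr0 s s.2) (fun t ht s s' => hv t ht s s.2 s' s'.2)
    · rintro ⟨s, hs⟩ ⟨s', hs'⟩
      refine toM hs hs' (N := d * (4 * Real.tan (2 * Real.pi / 5) ^ 2 * L₁)) ?_ ?_
      · simp only [hr]
        rw [← mul_sub, abs_mul, abs_of_pos hd, mul_assoc, mul_assoc _ L₁]
        gcongr
        exact (abs_legRadius_sub_le (starRatio_le hs) (starRatio_le hs')).trans
          (mul_le_mul_of_nonneg_left (hlip₁ s hs s' hs') (by positivity))
      · exact le_add_of_nonneg_right (by positivity)
    · rintro ⟨s, hs⟩ ⟨s', hs'⟩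
      refine toM hs hs' (N := |ε| * L₂) ?_ ?_
      · simp only [hz]
        rw [← mul_sub, abs_mul, abs_neg, mul_assoc]
        gcongr
        exact hlip₂ s hs s' hs'
      · exact le_add_of_nonneg_left (by positivity)
    · simp [hr, starRatio_zero, starRatio_eight]
    · simp [hz, starHeight_zero, starHeight_eight]

/-! ### The eight vectors -/

/-- The vectors of the star polygon: lifts of the edges of the pentagon, and vertical vectors. -/
noncomputable def starVector (R φ ε : ℝ) (j : Fin 8) : EuclideanSpace ℝ (Fin 3) :=
  if j.val < 5 then
    !₂[pentagonEdge R φ j.val 0, pentagonEdge R φ j.val 1,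
      -ε * (![-125, -50, 100, 100, -50, 7, 11, 7] : Fin 8 → ℝ) j]
  else !₂[0, 0, -ε * (![-125, -50, 100, 100, -50, 7, 11, 7] : Fin 8 → ℝ) j]

def starOrder : Equiv.Perm (Fin 8) where
  toFun := ![0, 3, 5, 1, 6, 4, 7, 2]
  invFun := ![0, 3, 7, 1, 5, 2, 4, 6]
  left_inv := by decide
  right_inv := by decide

theorem isStarOrdering_starOrder : IsStarOrdering starOrder :=
  ⟨⟨![0, 1, 3, 5, 7], by decide, by decide⟩, by decide⟩

theorem projectsToPentagon_starVector (R φ ε : ℝ) (hε : ε = 1 ∨ ε = -1) :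
    ProjectsToPentagon R φ (starVector R φ ε) := by
  constructor
  · intro j hj
    rw [starVector, if_pos hj]
    ext i
    fin_cases i <;> simp [horizontalProj]
  · intro j hj
    have hi : ∃ k : ℤ, k ≠ 0 ∧
        ((![-125, -50, 100, 100, -50, 7, 11, 7] : Fin 8 → ℝ) j) = k := by
      refine ⟨(![-125, -50, 100, 100, -50, 7, 11, 7] : Fin 8 → ℤ) j, ?_, ?_⟩ <;>
        fin_cases j <;> simp
    obtain ⟨k, hk, hk'⟩ := hi
    rw [starVector, if_neg (by omega), hk']
    rcases hε with rfl | rfl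
    · exact ⟨-k, by simpa using hk, by simp⟩
    · exact ⟨k, hk, by simp⟩

/-- The vertices of the star, with its centre at the origin. -/
noncomputable def starX (R φ : ℝ) (k : ℕ) : ℝ :=
  R / (2 * Real.cos (Real.pi / 5)) * Real.cos (φ + 8 * Real.pi / 5 - 4 * Real.pi * k / 5)

noncomputable def starY (R φ : ℝ) (k : ℕ) : ℝ :=
  R / (2 * Real.cos (Real.pi / 5)) * Real.sin (φ + 8 * Real.pi / 5 - 4 * Real.pi * k / 5)

theorem pentagonEdge_apply_zero {R φ : ℝ} {j m : ℕ} (k : ℕ) (h : 2 * j + 4 * m = 10 * k) :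
    pentagonEdge R φ j 0 = starX R φ (m + 1) - starX R φ m := by
  have h' : 2 * (j : ℝ) + 4 * (m : ℝ) = 10 * ((k : ℤ) : ℝ) := by exact_mod_cast h
  have := cos_sub_cos_pentagon (R := R) (φ := φ) h'
  simpa [pentagonEdge, pentagonVertex, starX] using this

theorem pentagonEdge_apply_one {R φ : ℝ} {j m : ℕ} (k : ℕ) (h : 2 * j + 4 * m = 10 * k) :
    pentagonEdge R φ j 1 = starY R φ (m + 1) - starY R φ m := by
  have h' : 2 * (j : ℝ) + 4 * (m : ℝ) = 10 * ((k : ℤ) : ℝ) := by exact_mod_cast h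
  have := sin_sub_sin_pentagon (R := R) (φ := φ) h'
  simpa [pentagonEdge, pentagonVertex, starY] using this

theorem starVector_starOrder_zero (R φ ε x : ℝ) (i : Fin 8) :
    x * starVector R φ ε (starOrder i) 0 =
      insertVertical (fun k y => y * (starX R φ (k + 1) - starX R φ k)) i x := by
  have h0 := pentagonEdge_apply_zero (R := R) (φ := φ) (j := 0) (m := 0) 0 rfl
  have h1 := pentagonEdge_apply_zero (R := R) (φ := φ) (j := 3) (m := 1) 1 rfl
  have h2 := pentagonEdge_apply_zero (R := R) (φ := φ) (j := 1) (m := 2) 1 rfl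
  have h3 := pentagonEdge_apply_zero (R := R) (φ := φ) (j := 4) (m := 3) 2 rfl
  have h4 := pentagonEdge_apply_zero (R := R) (φ := φ) (j := 2) (m := 4) 2 rfl
  fin_cases i <;> simp [starVector, starOrder, insertVertical, h0, h1, h2, h3, h4]

theorem starVector_starOrder_one (R φ ε x : ℝ) (i : Fin 8) :
    x * starVector R φ ε (starOrder i) 1 =
      insertVertical (fun k y => y * (starY R φ (k + 1) - starY R φ k)) i x := by
  have h0 := pentagonEdge_apply_one (R := R) (φ := φ) (j := 0) (m := 0) 0 rfl
  have h1 := pentagonEdge_apply_one (R := R) (φ := φ) (j := 3) (m := 1) 1 rfl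
  have h2 := pentagonEdge_apply_one (R := R) (φ := φ) (j := 1) (m := 2) 1 rfl
  have h3 := pentagonEdge_apply_one (R := R) (φ := φ) (j := 4) (m := 3) 2 rfl
  have h4 := pentagonEdge_apply_one (R := R) (φ := φ) (j := 2) (m := 4) 2 rfl
  fin_cases i <;> simp [starVector, starOrder, insertVertical, h0, h1, h2, h3, h4]

theorem starVector_starOrder_two (R φ ε : ℝ) (i : Fin 8) :
    starVector R φ ε (starOrder i) 2 = -ε * starSteps i := by
  fin_cases i <;> simp [starVector, starOrder, starSteps]

theorem sum_starVector (R φ ε : ℝ) : ∑ i, starVector R φ ε (starOrder i) = 0 := by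
  -- Five turns by $4\pi/5$ make two full revolutions.
  have hper : starX R φ 5 = starX R φ 0 ∧ starY R φ 5 = starY R φ 0 := by
    have : φ + 8 * Real.pi / 5 - 4 * Real.pi * (5 : ℕ) / 5 =
        φ + 8 * Real.pi / 5 - 4 * Real.pi * (0 : ℕ) / 5 - (2 : ℕ) * (2 * Real.pi) := by
      push_cast; ring
    rw [starX, starY, starX, starY, this, Real.cos_sub_nat_mul_two_pi, Real.sin_sub_nat_mul_two_pi]
    exact ⟨rfl, rfl⟩
  ext l
  rw [WithLp.ofLp_sum, Finset.sum_apply]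
  fin_cases l
  · have : ∀ i, starVector R φ ε (starOrder i) 0 = _ := fun i =>
      (one_mul _).symm.trans (starVector_starOrder_zero R φ ε 1 i)
    simp only [Fin.zero_eta, this, Fin.sum_univ_eight]
    simp [insertVertical, hper.1]
  · have : ∀ i, starVector R φ ε (starOrder i) 1 = _ := fun i =>
      (one_mul _).symm.trans (starVector_starOrder_one R φ ε 1 i)
    simp only [Fin.mk_one, this, Fin.sum_univ_eight]
    simp [insertVertical, hper.2]
  · simp only [Fin.reduceFinMk, starVector_starOrder_two, ← Finset.mul_sum, sum_starSteps]
    simp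

/-- Translation by vertex $0$ of the centred star moves the centre of the polygon's star to the
axis, and the rotation gives the starting corner angle $0$. With heights $-\varepsilon H$, a twist
of rate $\varepsilon\kappa$ contributes $-\kappa H$ because $\varepsilon^2=1$, so both mirror images
share one angle function. -/
theorem helicalHomeomorph_star {R φ ε : ℝ} (hε : ε = 1 ∨ ε = -1) (κ : ℝ) {s : ℝ}
    (hs : s ∈ Icc (0 : ℝ) 8) :
    helicalHomeomorph (starX R φ 0) (starY R φ 0) (-(φ + 8 * Real.pi / 5)) (ε * κ)
        (tipToTailPath (starVector R φ ε ∘ starOrder) s) =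
      cylPoint (R / (2 * Real.cos (Real.pi / 5)) * Real.cos (2 * Real.pi / 5) *
        legRadius (starRatio s)) (starAngle s - κ * starHeight s) (-ε * starHeight s) := by
  have hcoord : ∀ l, tipToTailPath (starVector R φ ε ∘ starOrder) s l =
      ∑ i : Fin 8, ramp (s - (i : ℕ)) * starVector R φ ε (starOrder i) l := by
    intro l
    rw [tipToTailPath, WithLp.ofLp_sum, Finset.sum_apply]
    rfl
  obtain ⟨m, y, hy, hA, hb, hP, -⟩ := exists_leg_angle hs
  have h2 : tipToTailPath (starVector R φ ε ∘ starOrder) s 2 = -ε * starHeight s := by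
    rw [hcoord, starHeight, Finset.mul_sum]
    refine Finset.sum_congr rfl fun i _ => ?_
    rw [starVector_starOrder_two]
    ring
  have hB : ∀ x : ℕ, φ + 8 * Real.pi / 5 - 4 * Real.pi * (x : ℝ) / 5 =
      φ + 8 * Real.pi / 5 - 4 * Real.pi * (x : ℝ) / 5 - 2 * Real.pi / 5 + 2 * Real.pi / 5 :=
    fun x => by ring
  have hB' : ∀ x : ℕ, φ + 8 * Real.pi / 5 - 4 * Real.pi * ((x + 1 : ℕ) : ℝ) / 5 =
      φ + 8 * Real.pi / 5 - 4 * Real.pi * (x : ℝ) / 5 - 2 * Real.pi / 5 - 2 * Real.pi / 5 :=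
    fun x => by push_cast; ring
  have hang : starAngle s - -(φ + 8 * Real.pi / 5) = φ + 8 * Real.pi / 5 -
      4 * Real.pi * ((m : ℕ) : ℝ) / 5 - 2 * Real.pi / 5 + 2 * Real.pi / 5 - legAngle y := by
    rw [hA]; ring
  rw [helicalHomeomorph_apply_of_polar (ρ := R / (2 * Real.cos (Real.pi / 5)) *
    Real.cos (2 * Real.pi / 5) * legRadius (starRatio s)) (θ := starAngle s), h2]
  · congr 1
    have hε2 : ε * ε = 1 := by rcases hε with rfl | rfl <;> norm_num
    linear_combination (-κ * starHeight s) * hε2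
  · rw [hcoord, hang, hb, ← lerp_cos_eq_polar, add_comm]
    simp only [starVector_starOrder_zero]
    rw [hP (starX R φ), starX, starX, hB' m, ← hB m]
  · rw [hcoord, hang, hb, ← lerp_sin_eq_polar, add_comm]
    simp only [starVector_starOrder_one]
    rw [hP (starY R φ), starY, starY, hB' m, ← hB m]

theorem mainTheorem7 (R φ : ℝ) (hR : 0 < R) (ε : ℝ) (hε : ε = 1 ∨ ε = -1) :
    ∃ (w : Fin 8 → EuclideanSpace ℝ (Fin 3)) (σ : Equiv.Perm (Fin 8)),
      ProjectsToPentagon R φ w ∧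
      IsStarOrdering σ ∧
      ∑ i, w (σ i) = 0 ∧
      IsSimplePolygon (tipToTail (w ∘ σ)) ∧
      AmbientIsotopic ((tipToTail (w ∘ σ)).boundary ℝ) (fiveOneKnot ε) := by
  have hc := cos_pi_div_five_pos
  have hc2 := cos_two_pi_div_five_pos
  have hsum : ∑ i, (starVector R φ ε ∘ starOrder) i = 0 := sum_starVector R φ ε
  obtain ⟨hinj, hiso⟩ := star_injective_and_isotopic (by positivity) hε
    (fun κ s hs => helicalHomeomorph_star (R := R) (φ := φ) hε κ hs)
  refine ⟨starVector R φ ε, starOrder, projectsToPentagon_starVector R φ ε hε,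
    isStarOrdering_starOrder, hsum, ?_, ?_⟩
  · refine isSimplePolygon_tipToTail _ hsum fun s hs s' hs' h heq => ?_
    push_cast at hs hs' ⊢
    exact hinj s hs s' hs' h heq
  · rw [boundary_tipToTail _ (by norm_num) hsum]
    push_cast
    exact hiso
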